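/- Let $(Y_t,J_t)_{t\ge 0}$ be a level-independent quasi-birth-and-death (QBD) process: a continuous-time Markov chain on $\{0,1,2,\dots\}\times\Phi$ (level, phase), where the phase space $\Phi$ is finite or countably infinite, whose (conservative, finite-rate) generator is block tridiagonal, with blocks $Q_0$ (one level up), $Q_1$ (same level), $Q_2$ (one level down) at all levels, except that $\tilde Q_1$ replaces $Q_1$ at level $0$. Suppose that * the QBD process is irreducible; * the doubly infinite chain on $\mathbb Z\times\Phi$ with the blocks $Q_0,Q_1,Q_2$ at every level is irreducible; * the mean drift is negative: there is a probability vector $\mathbf x$ on $\Phi$ with $\mathbf x(Q_0+Q_1+Q_2)=\mathbf 0$ and $\mathbf xQ_0\mathbf 1<\mathbf xQ_2\mathbf 1$. Let $T_0^K$ be the first time at which the level is $0$ or $K$, let $$P_k^K(i,j)=\mathbb P_{(k,i)}\bigl(T_0^K<\infty,\ Y_{T_0^K}=K,\ J_{T_0^K}=j\bigr),$$ and let $H$ be the elementwise increasing limit of the matrices $H_k=P_k^{k+1}$, $k\to\infty$. Then there is a unique set of phases $\Sigma^*\subseteq\Phi$ that is non-empty and such that, with the phases in $\Sigma^*$ listed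 first, $$H=\begin{bmatrix}L_1&0\\ L_{\cdot 1}&L_{\cdot}\end{bmatrix},$$ where $L_1$, the block of $\Sigma^*$, is irreducible and aperiodic (so primitive if $\Sigma^*$ is finite), and $L_\cdot$ is lower triangular with zero diagonal in the sense that the phases $i\notin\Sigma^*$ can be given ranks $r(i)\in\{0,1,2,\dots\}$ with $r(j)<r(i)$ whenever $L_\cdot(i,j)>0$. (If all of $H$ is irreducible and aperiodic, $\Sigma^*=\Phi$.) Moreover: 1. The power series $\sum_n L_1^n(i,j)z^n$, $i,j\in\Sigma^*$, have a common radius of convergence $1/c$ with $0<c<\infty$ ($c$ is the convergence norm of $L_1$). For every phase $i$ and every $j\in\Sigma^*$ there is $k^*$ such that for all $k>k^*$ one has $P_k^K(i,j)>0$ for all large $K$, and $$\lim_{K\to\infty}\frac{\log P_k^K(i,j)}{K}=\log c .$$ 2. For all $i,j\notin\Sigma^*$ and every $k\ge 0$ there is $K^*$ such that $P_k^K(i,j)=0$ for all $K>K^*$. 3. For all $i\in\Sigma^*$, $j\notin\Sigma^*$ and all $0\le k<K$, $P_k^K(i,j)=0$. -/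

import Mathlib

open MeasureTheory ProbabilityTheory Filter Topology
open scoped ENNReal NNReal

noncomputable section

/-! ### Continuous-time Markov chains on a countable state space -/

/-- The generator of a continuous-time Markov chain: finite rates, nonnegative off the diagonal,
and every row sums to zero. -/
structure CTGenerator (S : Type*) where
  rate : S → S → ℝ
  rate_nonneg : ∀ a b, a ≠ b → 0 ≤ rate a b
  hasSum_rate : ∀ a, HasSum (rate a) 0

namespace CTGenerator

variable {S : Type*} (G : CTGenerator S)

/-- The total rate out of the state `a`. -/
def exitRate (a : S) : ℝ := - G.rate a a

open Classical in
/-- The transition probabilities of the embedded jump chain: `rate a b / exitRate a` for `b ≠ a`,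
and an absorbing state is kept for ever. -/
def jumpProb (a b : S) : ℝ≥0∞ :=
  if G.exitRate a = 0 then (if b = a then 1 else 0)
  else if b = a then 0 else ENNReal.ofReal (G.rate a b / G.exitRate a)

open Classical in
lemma hasSum_off_diag (a : S) :
    HasSum (fun b => if b = a then 0 else G.rate a b) (G.exitRate a) := by
  have h := (G.hasSum_rate a).update a 0
  have e : Function.update (G.rate a) a 0 = fun b => if b = a then 0 else G.rate a b := by
    ext b
    by_cases hb : b = a <;> simp [hb]
  rw [e] at h
  simpa [exitRate] using h

lemma exitRate_nonneg (a : S) : 0 ≤ G.exitRate a := by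
  classical
  refine (G.hasSum_off_diag a).nonneg fun b => ?_
  by_cases hb : b = a
  · simp [hb]
  · simpa [hb] using G.rate_nonneg a b (Ne.symm hb)

lemma hasSum_jumpProb (a : S) : HasSum (G.jumpProb a) 1 := by
  classical
  by_cases h0 : G.exitRate a = 0
  · have : G.jumpProb a = fun b => if b = a then (1 : ℝ≥0∞) else 0 := by
      ext b; simp [jumpProb, h0]
    rw [this]
    exact hasSum_ite_eq a 1
  · have hs := (G.hasSum_off_diag a).div_const (G.exitRate a)
    rw [div_self h0] at hs
    have e : G.jumpProb a = fun b =>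
        ENNReal.ofReal ((if b = a then 0 else G.rate a b) / G.exitRate a) := by
      ext b
      by_cases hb : b = a <;> simp [jumpProb, h0, hb]
    have hn : ∀ b, 0 ≤ (if b = a then 0 else G.rate a b) / G.exitRate a := by
      intro b
      refine div_nonneg ?_ (G.exitRate_nonneg a)
      by_cases hb : b = a
      · simp [hb]
      · simpa [hb] using G.rate_nonneg a b (Ne.symm hb)
    rw [e, ENNReal.summable.hasSum_iff, ← ENNReal.ofReal_tsum_of_nonneg hn hs.summable,
      hs.tsum_eq, ENNReal.ofReal_one]

/-- The law of the next state of the jump chain. -/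
def jumpPMF (a : S) : PMF S := ⟨G.jumpProb a, G.hasSum_jumpProb a⟩

variable [MeasurableSpace S] [DiscreteMeasurableSpace S] [Countable S]

/-- The one-step kernel of the jump chain. -/
def jumpKernel : Kernel S S := Kernel.ofFunOfCountable fun a => (G.jumpPMF a).toMeasure

instance : IsMarkovKernel G.jumpKernel :=
  ⟨fun a => by
    change IsProbabilityMeasure (G.jumpPMF a).toMeasure
    infer_instance⟩

/-- The one-step kernel, as a function of the history up to time `n`: only the present state
matters. -/
def historyKernel (n : ℕ) : Kernel (Π _ : Finset.Iic n, S) S :=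
  G.jumpKernel.comap (fun h => h ⟨n, Finset.mem_Iic.2 le_rfl⟩) (measurable_pi_apply _)

instance (n : ℕ) : IsMarkovKernel (G.historyKernel n) := by
  unfold historyKernel
  infer_instance

/-- The law of the jump chain started in `s`. -/
def jumpChainLaw (s : S) : Measure (ℕ → S) :=
  Kernel.trajMeasure (X := fun _ => S) (Measure.dirac s) G.historyKernel

/-- The sample space of the chain: the trajectory of the jump chain, and a sequence of clocks. -/
abbrev PathSpace (S : Type*) : Type _ := (ℕ → S) × (ℕ → ℝ)

/-- The probability measure under which the chain starts in `s`: the jump chain starts in `s`, and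
the clocks are independent of it and of each other, and exponential with mean one. -/
def law (s : S) : Measure (PathSpace S) :=
  (G.jumpChainLaw s).prod (Measure.infinitePi fun _ : ℕ => expMeasure 1)

end CTGenerator

namespace CTGenerator

variable {S : Type*} (G : CTGenerator S)

/-- The time spent in the `n`-th state visited: the `n`-th clock divided by the exit rate of that
state, hence exponential with that rate (and infinite in an absorbing state). -/
def holdingTime (ω : PathSpace S) (n : ℕ) : ℝ≥0∞ :=
  ENNReal.ofReal (ω.2 n) / ENNReal.ofReal (G.exitRate (ω.1 n))

/-- The time of the `n`-th jump; the `0`-th is the time zero. -/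
def jumpTime (ω : PathSpace S) (n : ℕ) : ℝ≥0∞ := ∑ m ∈ Finset.range n, G.holdingTime ω m

open Classical in
/-- The (minimal) continuous-time Markov chain: its state at the time `t` is the `n`-th state of
the jump chain if `t` lies between the `n`-th and the next jump. It is `none` from the time at
which infinitely many jumps have accumulated, if there is such a time. -/
def process (t : ℝ≥0) (ω : PathSpace S) : Option S :=
  if h : ∃ n, G.jumpTime ω n ≤ t ∧ (t : ℝ≥0∞) < G.jumpTime ω (n + 1) then
    some (ω.1 (Nat.find h))
  else none

end CTGenerator

/-- Irreducibility of the chain with the off-diagonal rates `q`: every state leads to every other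
one along transitions of positive rate. -/
def RatesIrreducible {S : Type*} (q : S → S → ℝ) : Prop :=
  ∀ a b, Relation.ReflTransGen (fun x y => x ≠ y ∧ 0 < q x y) a b

/-! ### Quasi-birth-and-death processes -/

/-- A level-independent QBD process with phase space `Φ`: a continuous-time Markov chain on
`ℕ × Φ` (level, phase) whose generator is block tridiagonal, with the blocks `Q0` (one level up),
`Q1` (same level), `Q2` (one level down), and `Q1b` in place of `Q1` at the level zero. -/
structure QBD (Φ : Type*) where
  generator : CTGenerator (ℕ × Φ)
  Q0 : Matrix Φ Φ ℝ
  Q1 : Matrix Φ Φ ℝ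
  Q2 : Matrix Φ Φ ℝ
  Q1b : Matrix Φ Φ ℝ
  rate_eq : ∀ (k l : ℕ) (i j : Φ), generator.rate (k, i) (l, j) =
    if l = k + 1 then Q0 i j
    else if l = k then (if k = 0 then Q1b i j else Q1 i j)
    else if k = l + 1 then Q2 i j
    else 0

namespace QBD

variable {Φ : Type*} (X : QBD Φ)

/-- The QBD process is irreducible. -/
def Irreducible : Prop := RatesIrreducible X.generator.rate

/-- The generator of the doubly infinite chain on `ℤ × Φ`, which has no boundary level. -/
def doublyInfiniteRate (a b : ℤ × Φ) : ℝ :=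
  if b.1 = a.1 + 1 then X.Q0 a.2 b.2
  else if b.1 = a.1 then X.Q1 a.2 b.2
  else if a.1 = b.1 + 1 then X.Q2 a.2 b.2
  else 0

/-- The doubly infinite chain is irreducible. -/
def DoublyInfiniteIrreducible : Prop := RatesIrreducible X.doublyInfiniteRate

/-- The average drift of the level is negative: there is a probability vector `x` with
`x (Q0 + Q1 + Q2) = 0` and `x Q0 1 < x Q2 1`. -/
def NegativeDrift : Prop :=
  ∃ x : Φ → ℝ, (∀ i, 0 ≤ x i) ∧ HasSum x 1 ∧
    (∀ j, HasSum (fun i => x i * (X.Q0 + X.Q1 + X.Q2) i j) 0) ∧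
    (∑' i, ∑' j, ENNReal.ofReal (x i * X.Q0 i j)) <
      ∑' i, ∑' j, ENNReal.ofReal (x i * X.Q2 i j)

/-- The first time at which the level is `a` or `b` (infinite if there is none). -/
def exitTime (a b : ℕ) (ω : CTGenerator.PathSpace (ℕ × Φ)) : ℝ≥0∞ :=
  sInf ((fun t : ℝ≥0 => (t : ℝ≥0∞)) ''
    {t : ℝ≥0 | ∃ s : ℕ × Φ, X.generator.process t ω = some s ∧ (s.1 = a ∨ s.1 = b)})

variable [MeasurableSpace Φ] [DiscreteMeasurableSpace Φ] [Countable Φ]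

/-- The probability, starting from the level `k` and the phase `i`, that the level reaches `0` or
`K` and that at the first such time the level is `K` and the phase is `j`. -/
def hitProb (k K : ℕ) (i j : Φ) : ℝ≥0∞ :=
  X.generator.law (k, i)
    {ω | ∃ t : ℝ≥0, (t : ℝ≥0∞) = X.exitTime 0 K ω ∧ X.generator.process t ω = some (K, j)}

/-- The elementwise increasing limit of the matrices `hitProb k (k + 1)`. -/
def H (i j : Φ) : ℝ≥0∞ := ⨆ k : ℕ, X.hitProb k (k + 1) i j

end QBD

/-! ### Nonnegative matrices of arbitrary size -/

open Classical in
/-- The powers of a nonnegative matrix. -/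
def nnPow {ι : Type*} (A : ι → ι → ℝ≥0∞) : ℕ → ι → ι → ℝ≥0∞
  | 0 => fun i j => if i = j then 1 else 0
  | n + 1 => fun i j => ∑' l, nnPow A n i l * A l j

/-- `A` is irreducible. -/
def NNIrreducible {ι : Type*} (A : ι → ι → ℝ≥0∞) : Prop :=
  ∀ i j, ∃ n, 0 < n ∧ 0 < nnPow A n i j

/-- `A` is aperiodic: for each `i`, the `n` with a positive `(i, i)` entry of `A ^ n` have the
greatest common divisor one. -/
def NNAperiodic {ι : Type*} (A : ι → ι → ℝ≥0∞) : Prop :=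
  ∀ i, ∀ d : ℕ, (∀ n, 0 < nnPow A n i i → d ∣ n) → d = 1

/-- The radius of convergence of the power series `∑ k, (A ^ k) i j * z ^ k`. -/
def entryRadius {ι : Type*} (A : ι → ι → ℝ≥0∞) (i j : ι) : ℝ≥0∞ :=
  ⨆ z : {z : ℝ≥0 // ∑' k, nnPow A k i j * (z : ℝ≥0∞) ^ k ≠ ∞}, ((z : ℝ≥0) : ℝ≥0∞)

/-- `c` is the convergence norm of `A`: the radius of convergence of the series
`∑ k, (A ^ k) i j * z ^ k` is `1 / c`, for all `i` and `j`. -/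
def IsConvergenceNorm {ι : Type*} (A : ι → ι → ℝ≥0∞) (c : ℝ≥0∞) : Prop :=
  ∀ i j, entryRadius A i j = c⁻¹

/-- The diagonal block of `A` on the index set `C`. -/
def diagBlock {ι : Type*} (A : ι → ι → ℝ≥0∞) (C : Set ι) : C → C → ℝ≥0∞ :=
  fun i j => A i j

/-- `A` has the block form `[L₁ 0; L.₁ L.]`, where `L₁` is the block of the nonempty index set
`C` and is irreducible and aperiodic (that is, primitive if `C` is finite), and `L.` is lower
triangular with zero diagonal for a suitable arrangement of the indices outside `C`: they can be
given ranks in `ℕ` such that `L.` leads only from higher to strictly lower ranks. For an infinite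
matrix several indices, even infinitely many, may have to share a rank. -/
structure IsPrimitiveDecomposition {ι : Type*} (A : ι → ι → ℝ≥0∞) (C : Set ι) : Prop where
  nonempty : C.Nonempty
  irreducible : NNIrreducible (diagBlock A C)
  aperiodic : NNAperiodic (diagBlock A C)
  upper_right : ∀ i ∈ C, ∀ j ∉ C, A i j = 0
  lower_triangular : ∃ r : ι → ℕ, ∀ i ∉ C, ∀ j ∉ C, A i j ≠ 0 → r j < r i

end

noncomputable section

/-! ### Powers of nonnegative matrices -/

section NNPow

variable {ι : Type*}

/-! Everything is reduced to the powers of `H`. Whether the level hits `0` or `K` first depends on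
the jump chain alone, so `hitProb` is a potential: a sum of powers of the jump matrix with the rows
of the target set deleted. Away from level `0` the jump chain is translation invariant and gains at
most one level per step. Hence `hitProb k (k + n)` is the probability that the free chain climbs `n`
levels without first descending `k`; as `k` grows it increases to `ladder n`. A climb of `m + n`
levels splits at level `m`, so `ladder n` is the `n`-th power of `H` (`ladder_eq_iSup`,
`ladder_add`, `nnPow_H_eq_iSup`).

Irreducibility of the doubly infinite chain gives a path from `(0, i)` to `(a, j)`. Following it
first shows that row `i` of `H ^ N` dominates a positive multiple of row `j` of `H ^ (N - a)` for
all large `N`. This property, `ShiftComparable`, carries the whole structure theorem. The set sought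
consists of the indices on cycles. The shifts `a` reach every residue of the exponent, so a cyclic
index is reached from everywhere at all large times; this gives irreducibility, aperiodicity and
uniqueness. Comparison with a cyclic row shows that each row of `H ^ N` is eventually supported on
cyclic indices, and the time at which this begins is the rank.

For the decay rate, `hitProb k K` is at most an entry of `H ^ (K - k)`, a term of a series
converging inside the common radius. Beyond the radius some `n`-step return of `H` has weight above
one. Being a supremum, it is already attained up to that bound by `hitProb` from a finite level,
hence from all higher levels, and supermultiplicativity (`hitProb_mul_le`) iterates it. -/

lemma nnPow_zero_self (A : ι → ι → ℝ≥0∞) (i : ι) : nnPow A 0 i i = 1 := by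
  simp [nnPow]

lemma nnPow_one (A : ι → ι → ℝ≥0∞) (i j : ι) : nnPow A 1 i j = A i j := by
  classical
  have : nnPow A 1 i j = ∑' l, (if i = l then 1 else 0) * A l j := by
    simp [nnPow]
  rw [this, tsum_eq_single i (fun l hl => by simp [Ne.symm hl])]
  simp

lemma nnPow_add (A : ι → ι → ℝ≥0∞) (m n : ℕ) (i j : ι) :
    nnPow A (m + n) i j = ∑' l, nnPow A m i l * nnPow A n l j := by
  classical
  induction n generalizing j with
  | zero =>
    rw [tsum_eq_single j (fun l hl => by simp [nnPow, hl])]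
    simp [nnPow]
  | succ n ih =>
    change (∑' l, nnPow A (m + n) i l * A l j) = ∑' l, nnPow A m i l * ∑' r, nnPow A n l r * A r j
    simp_rw [ih, ← ENNReal.tsum_mul_left, ← ENNReal.tsum_mul_right]
    rw [ENNReal.tsum_comm]
    simp_rw [mul_assoc]

lemma nnPow_succ_left (A : ι → ι → ℝ≥0∞) (n : ℕ) (i j : ι) :
    nnPow A (n + 1) i j = ∑' l, A i l * nnPow A n l j := by
  rw [add_comm, nnPow_add]
  simp_rw [nnPow_one]

lemma nnPow_mul_le (A : ι → ι → ℝ≥0∞) (m n : ℕ) (i l j : ι) :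
    nnPow A m i l * nnPow A n l j ≤ nnPow A (m + n) i j := by
  rw [nnPow_add]
  exact ENNReal.le_tsum (f := fun l => nnPow A m i l * nnPow A n l j) l

lemma nnPow_add_ne_zero {A : ι → ι → ℝ≥0∞} {m n : ℕ} {i l j : ι} (h : nnPow A m i l ≠ 0)
    (h' : nnPow A n l j ≠ 0) : nnPow A (m + n) i j ≠ 0 := fun h0 =>
  mul_ne_zero h h' (le_zero_iff.1 (h0 ▸ nnPow_mul_le A m n i l j))

lemma nnPow_mono {A B : ι → ι → ℝ≥0∞} (h : ∀ i j, A i j ≤ B i j) (n : ℕ) (i j : ι) :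
    nnPow A n i j ≤ nnPow B n i j := by
  induction n generalizing j with
  | zero => exact le_rfl
  | succ n ih => exact ENNReal.tsum_le_tsum fun l => mul_le_mul' (ih l) (h l j)

/-- Powers of a matrix whose rows over the range of `f` vanish outside that range. -/
lemma nnPow_comp_injective {κ : Type*} {f : ι → κ} (hf : f.Injective) {A : ι → ι → ℝ≥0∞}
    {B : κ → κ → ℝ≥0∞} (hAB : ∀ i j, B (f i) (f j) = A i j)
    (h0 : ∀ i k, k ∉ Set.range f → B (f i) k = 0) (n : ℕ) (i j : ι) :
    nnPow B n (f i) (f j) = nnPow A n i j := by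
  induction n generalizing i with
  | zero =>
    by_cases h : i = j
    · simp [nnPow, h]
    · simp [nnPow, h, hf.ne h]
  | succ n ih =>
    rw [nnPow_succ_left, nnPow_succ_left,
      ← hf.tsum_eq (f := fun l => B (f i) l * nnPow B n l (f j))]
    · simp_rw [hAB, ih]
    · intro k hk
      by_contra h
      exact hk (by simp [h0 i k h])

end NNPow

/-! ### Potentials of nonnegative matrices -/

section Potential

variable {S : Type*}

open Classical in
/-- The matrix obtained from `q` by replacing the rows outside `A` by zero. -/
def rowRestrict (A : Set S) (q : S → S → ℝ≥0∞) (s t : S) : ℝ≥0∞ := if s ∈ A then q s t else 0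

/-- The potential `∑ n, (rowRestrict A q) ^ n`: its entry at `s` and `t ∉ A` is the total weight
of the paths which start in `s` and leave `A` in `t`. -/
def potential (A : Set S) (q : S → S → ℝ≥0∞) (s t : S) : ℝ≥0∞ :=
  ∑' n, nnPow (rowRestrict A q) n s t

variable {q : S → S → ℝ≥0∞} {A B : Set S}

lemma rowRestrict_of_mem {s : S} (hs : s ∈ A) (t : S) : rowRestrict A q s t = q s t := by
  simp [rowRestrict, hs]

lemma rowRestrict_of_notMem {s : S} (hs : s ∉ A) (t : S) : rowRestrict A q s t = 0 := by
  simp [rowRestrict, hs]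

open Classical in
lemma potential_eq (s t : S) : potential A q s t =
    (if s = t then 1 else 0) + ∑' u, rowRestrict A q s u * potential A q u t := by
  unfold potential
  rw [tsum_eq_zero_add' ENNReal.summable]
  congr 1
  simp_rw [nnPow_succ_left, ← ENNReal.tsum_mul_left]
  rw [ENNReal.tsum_comm]

lemma potential_of_mem {s t : S} (hs : s ∈ A) (hst : s ≠ t) :
    potential A q s t = ∑' u, q s u * potential A q u t := by
  rw [potential_eq]
  simp [hst, rowRestrict_of_mem hs]

open Classical in
lemma potential_of_notMem {s : S} (hs : s ∉ A) (t : S) :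
    potential A q s t = if s = t then 1 else 0 := by
  rw [potential_eq]
  simp [rowRestrict_of_notMem hs]

lemma mul_potential_le {s : S} (hs : s ∈ A) (u t : S) :
    q s u * potential A q u t ≤ potential A q s t := by
  classical
  rw [potential_eq s t]
  refine le_trans ?_ le_add_self
  rw [← rowRestrict_of_mem (q := q) hs u]
  exact ENNReal.le_tsum (f := fun u => rowRestrict A q s u * potential A q u t) u

lemma potential_mono (h : A ⊆ B) (s t : S) : potential A q s t ≤ potential B q s t := by
  refine ENNReal.tsum_le_tsum fun n => nnPow_mono (fun i j => ?_) n s t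
  by_cases hi : i ∈ A
  · rw [rowRestrict_of_mem hi, rowRestrict_of_mem (h hi)]
  · simp [rowRestrict_of_notMem hi]

/-- The potential of a nonnegative function is the least solution of its Poisson equation. -/
lemma tsum_potential_mul_le {φ g : S → ℝ≥0∞}
    (h : ∀ s, φ s + ∑' u, rowRestrict A q s u * g u ≤ g s) (s : S) :
    ∑' t, potential A q s t * φ t ≤ g s := by
  classical
  -- Truncation at `N` powers turns the bound into an induction on `N`, one application of `h` per
  -- step.
  have key : ∀ N s, ∑ n ∈ Finset.range N, ∑' t, nnPow (rowRestrict A q) n s t * φ t ≤ g s := by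
    intro N
    induction N with
    | zero => simp
    | succ N ih =>
      intro s
      rw [Finset.sum_range_succ']
      refine le_trans ?_ (h s)
      rw [add_comm]
      refine add_le_add (le_of_eq ?_) ?_
      · rw [tsum_eq_single s (fun t ht => by simp [nnPow, Ne.symm ht])]
        simp [nnPow]
      · calc ∑ n ∈ Finset.range N, ∑' t, nnPow (rowRestrict A q) (n + 1) s t * φ t
            = ∑ n ∈ Finset.range N, ∑' u, rowRestrict A q s u *
                ∑' t, nnPow (rowRestrict A q) n u t * φ t := by
              refine Finset.sum_congr rfl fun n _ => ?_
              simp_rw [nnPow_succ_left, ← ENNReal.tsum_mul_left, ← ENNReal.tsum_mul_right]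
              rw [ENNReal.tsum_comm]
              simp_rw [mul_assoc]
          _ = ∑' u, rowRestrict A q s u * ∑ n ∈ Finset.range N,
                ∑' t, nnPow (rowRestrict A q) n u t * φ t := by
              simp_rw [Finset.mul_sum]
              exact (Summable.tsum_finsetSum fun _ _ => ENNReal.summable).symm
          _ ≤ _ := ENNReal.tsum_le_tsum fun u => by gcongr; exact ih u
  have e : ∑' t, potential A q s t * φ t =
      ∑' n, ∑' t, nnPow (rowRestrict A q) n s t * φ t := by
    unfold potential
    simp_rw [← ENNReal.tsum_mul_right]
    rw [ENNReal.tsum_comm]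
  rw [e, ENNReal.tsum_eq_iSup_nat]
  exact iSup_le fun N => key N s

-- The minimality principle in the form used below: any supersolution of the first-step equation
-- bounds the potential.
open Classical in
lemma potential_le {t : S} {g : S → ℝ≥0∞}
    (h : ∀ s, (if s = t then 1 else 0) + ∑' u, rowRestrict A q s u * g u ≤ g s) (s : S) :
    potential A q s t ≤ g s := by
  have := tsum_potential_mul_le (φ := fun s => if s = t then 1 else 0) h s
  rwa [tsum_eq_single t (fun u hu => by simp [hu]), if_pos rfl, mul_one] at this

/-- Decomposition of a potential at the first exit from a smaller set. -/
lemma potential_eq_tsum_exit (hAB : A ⊆ B) {t : S} (ht : t ∉ A) (s : S) :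
    potential B q s t = ∑' u, potential A q s u * Aᶜ.indicator (fun v => potential B q v t) u := by
  classical
  -- Minimality is used in both directions: `potential B q · t` is a supersolution for `A`, and the
  -- sum over exit states is one for `B`. Since `t ∉ A`, no diagonal term arises inside `A`.
  have hle : ∀ s, ∑' u, potential A q s u * Aᶜ.indicator (fun v => potential B q v t) u ≤
      potential B q s t := by
    refine tsum_potential_mul_le fun s => ?_
    by_cases hs : s ∈ A
    · have hst : s ≠ t := fun h => ht (h ▸ hs)
      rw [potential_of_mem (hAB hs) hst]
      simp [hs, rowRestrict_of_mem hs]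
    · simp [hs, rowRestrict_of_notMem hs]
  refine le_antisymm ?_ (hle s)
  refine potential_le (g := fun s => ∑' u, potential A q s u *
    Aᶜ.indicator (fun v => potential B q v t) u) (fun s => ?_) s
  by_cases hs : s ∈ A
  · have hst : s ≠ t := fun h => ht (h ▸ hs)
    rw [if_neg hst, zero_add]
    simp_rw [rowRestrict_of_mem (hAB hs), ← ENNReal.tsum_mul_left]
    rw [ENNReal.tsum_comm]
    refine ENNReal.tsum_le_tsum fun u => ?_
    by_cases hu : u ∈ A
    · simp [hu]
    · have hsu : s ≠ u := fun h => hu (h ▸ hs)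
      rw [potential_of_mem hs hsu, ← ENNReal.tsum_mul_right]
      simp_rw [mul_assoc]
      exact le_rfl
  · rw [tsum_eq_single (f := fun u => potential A q s u * _) s
      (fun u hu => by simp [potential_of_notMem hs, Ne.symm hu])]
    rw [potential_of_notMem hs, if_pos rfl, one_mul, Set.indicator_of_mem (by exact hs),
      potential_eq s t]
    gcongr with u
    exact hle u

lemma potential_mul_le (hAB : A ⊆ B) {t u : S} (ht : t ∉ A) (hu : u ∉ A) (s : S) :
    potential A q s u * potential B q u t ≤ potential B q s t := by
  rw [potential_eq_tsum_exit hAB ht s]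
  have := ENNReal.le_tsum
    (f := fun u => potential A q s u * Aᶜ.indicator (fun v => potential B q v t) u) u
  simpa [hu] using this

lemma ENNReal.tsum_iSup_of_monotone {α : Type*} {f : ℕ → α → ℝ≥0∞} (hf : Monotone f) :
    ∑' a, ⨆ k, f k a = ⨆ k, ∑' a, f k a := by
  let _ : MeasurableSpace α := ⊤
  have := lintegral_iSup (μ := Measure.count) (f := f) (fun _ => measurable_from_top) hf
  simpa [lintegral_count] using this

/-- By minimality it suffices that the supremum solves the equation of the union, which is monotone
convergence. -/
lemma potential_iUnion {A : ℕ → Set S} (hA : Monotone A) (s t : S) :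
    potential (⋃ k, A k) q s t = ⨆ k, potential (A k) q s t := by
  classical
  refine le_antisymm ?_ (iSup_le fun k => potential_mono (Set.subset_iUnion A k) s t)
  refine potential_le (g := fun s => ⨆ k, potential (A k) q s t) (fun s => ?_) s
  have hmono : ∀ s, Monotone fun k => potential (A k) q s t :=
    fun s k l hkl => potential_mono (hA hkl) s t
  by_cases hs : s ∈ ⋃ k, A k
  · obtain ⟨k₀, hk₀⟩ := Set.mem_iUnion.1 hs
    simp_rw [rowRestrict_of_mem hs, ENNReal.mul_iSup]
    rw [ENNReal.tsum_iSup_of_monotone (f := fun k u => q s u * potential (A k) q u t)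
      (fun k l hkl u => mul_le_mul' le_rfl (hmono u hkl)), ENNReal.add_iSup]
    -- The row of `s` is switched on only from `k₀` onwards, hence the passage to `max k k₀`.
    refine iSup_le fun k => le_iSup_of_le (max k k₀) ?_
    rw [potential_eq s t]
    refine add_le_add le_rfl (ENNReal.tsum_le_tsum fun u => ?_)
    rw [rowRestrict_of_mem (hA (le_max_right k k₀) hk₀)]
    exact mul_le_mul' le_rfl (hmono u (le_max_left k k₀))
  · simp_rw [rowRestrict_of_notMem hs, zero_mul, tsum_zero, add_zero]
    refine le_iSup_of_le 0 ?_
    rw [potential_eq s t]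
    exact le_self_add

/-- Used twice: for translations of the levels, and for the embedding of `ℕ × Φ` into `ℤ × Φ`. Only
rows in `A` must agree, so the boundary row at level `0` does no harm. -/
lemma potential_comp_injective {S' : Type*} {f : S → S'} (hf : f.Injective)
    {q' : S' → S' → ℝ≥0∞} {A' : Set S'} (hA : ∀ s, f s ∈ A' ↔ s ∈ A)
    (hq : ∀ s ∈ A, ∀ t, q' (f s) (f t) = q s t)
    (h0 : ∀ s ∈ A, ∀ t, t ∉ Set.range f → q' (f s) t = 0) (s t : S) :
    potential A' q' (f s) (f t) = potential A q s t := by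
  refine tsum_congr fun n => nnPow_comp_injective hf (fun i j => ?_) (fun i k hk => ?_) n s t
  · by_cases h : i ∈ A
    · rw [rowRestrict_of_mem h, rowRestrict_of_mem ((hA i).2 h), hq i h]
    · rw [rowRestrict_of_notMem h, rowRestrict_of_notMem (mt (hA i).1 h)]
  · by_cases h : i ∈ A
    · rw [rowRestrict_of_mem ((hA i).2 h), h0 i h k hk]
    · rw [rowRestrict_of_notMem (mt (hA i).1 h)]

end Potential

/-! ### First entrance probabilities of the jump chain -/

namespace CTGenerator

variable {S : Type*} (G : CTGenerator S)

lemma measurableSet_coord_mem {S : Type*} [MeasurableSpace S] [DiscreteMeasurableSpace S]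
    (m : ℕ) (T : Set S) : MeasurableSet {x : ℕ → S | x m ∈ T} :=
  (measurable_pi_apply m) (MeasurableSet.of_discrete (s := T))

lemma measurableSet_forall_lt_coord_mem {S : Type*} [MeasurableSpace S]
    [DiscreteMeasurableSpace S] (n : ℕ) (T : Set S) :
    MeasurableSet {x : ℕ → S | ∀ m < n, x m ∈ T} := by
  have : {x : ℕ → S | ∀ m < n, x m ∈ T} = ⋂ m, ⋂ (_ : m < n), {x | x m ∈ T} := by
    ext x; simp
  rw [this]
  exact MeasurableSet.iInter fun m => MeasurableSet.iInter fun _ => measurableSet_coord_mem m T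

section Law

variable [MeasurableSpace S] [DiscreteMeasurableSpace S] [Countable S]

instance (s : S) : IsProbabilityMeasure (G.jumpChainLaw s) := by
  unfold jumpChainLaw
  infer_instance

instance (s : S) : IsProbabilityMeasure (G.law s) := by
  have : IsProbabilityMeasure (expMeasure 1) := isProbabilityMeasure_expMeasure one_pos
  unfold law
  infer_instance

lemma jumpKernel_singleton (a b : S) : G.jumpKernel a {b} = G.jumpProb a b := by
  change (G.jumpPMF a).toMeasure {b} = _
  rw [PMF.toMeasure_apply_singleton _ _ (measurableSet_singleton b)]
  rfl

lemma jumpChainLaw_map_zero (s : S) : (G.jumpChainLaw s).map (fun x => x 0) = Measure.dirac s := by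
  have e : (fun x : ℕ → S => x 0) =
      (MeasurableEquiv.piUnique (fun _ : Finset.Iic 0 => S)) ∘ Preorder.frestrictLe 0 := by
    ext x
    rfl
  rw [e, ← Measure.map_map (by fun_prop) (by fun_prop), jumpChainLaw, Kernel.trajMeasure,
    Measure.map_comp _ _ (by fun_prop), Kernel.traj_map_frestrictLe, Kernel.partialTraj_self]
  rw [Measure.id_comp, Measure.map_map (by fun_prop) (by fun_prop)]
  simp

/-- The Markov property of the jump chain, for events determined by the first `n + 1` states. -/
lemma jumpChainLaw_inter_succ (s : S) (n : ℕ) {E : Set (Π _ : Finset.Iic n, S)}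
    (hE : MeasurableSet E) (v u : S) :
    G.jumpChainLaw s {x | Preorder.frestrictLe n x ∈ E ∧ x n = v ∧ x (n + 1) = u} =
      G.jumpChainLaw s {x | Preorder.frestrictLe n x ∈ E ∧ x n = v} * G.jumpProb v u := by
  have h := Kernel.map_frestrictLe_trajMeasure_compProd_eq_map_trajMeasure
    (X := fun _ : ℕ => S) (μ₀ := Measure.dirac s) (κ := G.historyKernel) (a := n)
  have hn : Measurable fun y : Π _ : Finset.Iic n, S => y ⟨n, Finset.mem_Iic.2 le_rfl⟩ :=
    measurable_pi_apply _
  set F : Set (Π _ : Finset.Iic n, S) := E ∩ {y | y ⟨n, Finset.mem_Iic.2 le_rfl⟩ = v} with hF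
  have hFm : MeasurableSet F := hE.inter (hn (measurableSet_singleton v))
  have h2 := congrArg (fun μ => μ (F ×ˢ {u})) h
  beta_reduce at h2
  rw [Measure.compProd_apply_prod hFm (measurableSet_singleton u),
    Measure.map_apply (by fun_prop) (hFm.prod (measurableSet_singleton u))] at h2
  have h3 : ∫⁻ y in F, G.historyKernel n y {u}
      ∂(Kernel.trajMeasure (X := fun _ => S) (Measure.dirac s) G.historyKernel).map
        (Preorder.frestrictLe n) = ∫⁻ y in F, G.jumpProb v u
      ∂(Kernel.trajMeasure (X := fun _ => S) (Measure.dirac s) G.historyKernel).map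
        (Preorder.frestrictLe n) := by
    refine setLIntegral_congr_fun hFm fun y hy => ?_
    have hy2 : y ⟨n, Finset.mem_Iic.2 le_rfl⟩ = v := hy.2
    change G.jumpKernel (y ⟨n, Finset.mem_Iic.2 le_rfl⟩) {u} = _
    rw [hy2, jumpKernel_singleton]
  rw [h3, setLIntegral_const, Measure.map_apply (by fun_prop) hFm, mul_comm] at h2
  have e1 : {x : ℕ → S | Preorder.frestrictLe n x ∈ E ∧ x n = v ∧ x (n + 1) = u} =
      (fun x : ℕ → S => (Preorder.frestrictLe n x, x (n + 1))) ⁻¹' (F ×ˢ {u}) := by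
    ext x
    simp only [hF, Set.mem_ofPred_eq, Set.mem_preimage, Set.mem_prod, Set.mem_inter_iff,
      Set.mem_singleton_iff, and_assoc]
    rfl
  rw [e1]
  exact h2.symm

/-- The jump chain is in `u` at the time `n`, and was in `A` before. -/
lemma jumpChainLaw_stay (s : S) (A : Set S) (n : ℕ) (u : S) :
    G.jumpChainLaw s {x | x n = u ∧ ∀ m < n, x m ∈ A} =
      nnPow (rowRestrict A G.jumpProb) n s u := by
  classical
  induction n generalizing u with
  | zero =>
    have h := congrArg (fun μ => μ {u}) (G.jumpChainLaw_map_zero s)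
    beta_reduce at h
    rw [Measure.map_apply (measurable_pi_apply 0) (measurableSet_singleton u),
      Measure.dirac_apply] at h
    have e : {x : ℕ → S | x 0 = u ∧ ∀ m < 0, x m ∈ A} = (fun x : ℕ → S => x 0) ⁻¹' {u} := by
      ext x; simp
    rw [e, h]
    simp [nnPow, Set.indicator_apply]
  | succ n ih =>
    have e : {x : ℕ → S | x (n + 1) = u ∧ ∀ m < n + 1, x m ∈ A} =
        ⋃ v, {x | x n = v ∧ v ∈ A ∧ (∀ m < n, x m ∈ A) ∧ x (n + 1) = u} := by
      ext x
      simp only [Set.mem_ofPred_eq, Set.mem_iUnion]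
      constructor
      · rintro ⟨h1, h2⟩
        exact ⟨x n, rfl, h2 n n.lt_succ_self, fun m hm => h2 m (hm.trans n.lt_succ_self), h1⟩
      · rintro ⟨v, rfl, h2, h3, h4⟩
        refine ⟨h4, fun m hm => ?_⟩
        rcases Nat.lt_succ_iff_lt_or_eq.1 hm with h | rfl
        · exact h3 m h
        · exact h2
    have hm : ∀ v, MeasurableSet {x : ℕ → S | x n = v ∧ v ∈ A ∧ (∀ m < n, x m ∈ A) ∧
        x (n + 1) = u} := fun v => by
      exact (measurableSet_coord_mem n {v}).inter ((MeasurableSet.const _).inter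
        ((measurableSet_forall_lt_coord_mem n A).inter (measurableSet_coord_mem (n + 1) {u})))
    rw [e, measure_iUnion _ hm]
    · refine tsum_congr fun v => ?_
      by_cases hv : v ∈ A
      · have hE : MeasurableSet {y : Π _ : Finset.Iic n, S | ∀ m : Finset.Iic n, m.1 < n →
            y m ∈ A} := by
          have : {y : Π _ : Finset.Iic n, S | ∀ m : Finset.Iic n, m.1 < n → y m ∈ A} =
              ⋂ m : Finset.Iic n, ⋂ (_ : m.1 < n), {y | y m ∈ A} := by
            ext x; simp
          exact this ▸ MeasurableSet.iInter fun m => MeasurableSet.iInter fun _ =>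
            (measurable_pi_apply m) (MeasurableSet.of_discrete (s := A))
        have h := G.jumpChainLaw_inter_succ s n hE v u
        have hiff : ∀ x : ℕ → S, Preorder.frestrictLe n x ∈ {y : Π _ : Finset.Iic n, S |
            ∀ m : Finset.Iic n, m.1 < n → y m ∈ A} ↔ ∀ m < n, x m ∈ A := fun x =>
          ⟨fun h m hm => h ⟨m, Finset.mem_Iic.2 hm.le⟩ hm, fun h m hm => h m.1 hm⟩
        rw [rowRestrict_of_mem hv, ← ih v]
        convert h using 2
        · ext x
          have := hiff x
          simp only [Set.mem_ofPred_eq] at this ⊢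
          rw [this]
          tauto
        · congr 1
          ext x
          have := hiff x
          simp only [Set.mem_ofPred_eq] at this ⊢
          rw [this]
          tauto
      · simp [rowRestrict_of_notMem hv, hv]
    · intro v w hvw
      refine Set.disjoint_left.2 fun x hx hx' => hvw ?_
      exact hx.1.symm.trans hx'.1

/-- Since `u ∉ A`, the events for different `n` are disjoint and their probabilities add up to the
potential. -/
lemma jumpChainLaw_firstEntrance (s : S) {A : Set S} {u : S} (hu : u ∉ A) :
    G.jumpChainLaw s {x | ∃ n, x n = u ∧ ∀ m < n, x m ∈ A} = potential A G.jumpProb s u := by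
  rw [Set.ofPred_exists, measure_iUnion]
  · exact tsum_congr fun n => G.jumpChainLaw_stay s A n u
  · intro n m hnm
    refine Set.disjoint_left.2 fun x hx hx' => ?_
    rcases lt_or_gt_of_ne hnm with h | h
    · exact hu (hx.1 ▸ hx'.2 n h)
    · exact hu (hx'.1 ▸ hx.2 m h)
  · exact fun n => (measurableSet_coord_mem n {u}).inter (measurableSet_forall_lt_coord_mem n A)

end Law

/-! ### First entrance of the process -/

section Path

variable {G} {ω : PathSpace S}

lemma jumpTime_succ (n : ℕ) : G.jumpTime ω (n + 1) = G.jumpTime ω n + G.holdingTime ω n := by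
  simp [jumpTime, Finset.sum_range_succ]

lemma holdingTime_pos {n : ℕ} (hω : 0 < ω.2 n) :
    0 < G.holdingTime ω n :=
  ENNReal.div_pos (by simpa using hω) ENNReal.ofReal_ne_top

lemma holdingTime_ne_top (hG : ∀ a, G.exitRate a ≠ 0) (n : ℕ) : G.holdingTime ω n ≠ ∞ :=
  ENNReal.div_ne_top ENNReal.ofReal_ne_top
    (by simpa using (G.exitRate_nonneg (ω.1 n)).lt_of_ne' (hG (ω.1 n)))

lemma jumpTime_ne_top (hG : ∀ a, G.exitRate a ≠ 0) (n : ℕ) : G.jumpTime ω n ≠ ∞ :=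
  ENNReal.sum_ne_top.2 fun m _ => holdingTime_ne_top hG m

lemma jumpTime_mono : Monotone (G.jumpTime ω) :=
  monotone_nat_of_le_succ fun n => by rw [jumpTime_succ]; exact le_self_add

lemma jumpTime_lt_succ (hG : ∀ a, G.exitRate a ≠ 0) (hω : ∀ n, 0 < ω.2 n) (n : ℕ) :
    G.jumpTime ω n < G.jumpTime ω (n + 1) := by
  rw [jumpTime_succ]
  exact ENNReal.lt_add_right (jumpTime_ne_top hG n) (holdingTime_pos (hω n)).ne'

lemma process_eq_some_iff (t : ℝ≥0) (a : S) : G.process t ω = some a ↔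
    ∃ n, G.jumpTime ω n ≤ t ∧ (t : ℝ≥0∞) < G.jumpTime ω (n + 1) ∧ ω.1 n = a := by
  classical
  constructor
  · intro h
    unfold process at h
    split_ifs at h with h'
    exact ⟨_, (Nat.find_spec h').1, (Nat.find_spec h').2, Option.some.inj h⟩
  · rintro ⟨n, h1, h2, rfl⟩
    have h' : ∃ n, G.jumpTime ω n ≤ t ∧ (t : ℝ≥0∞) < G.jumpTime ω (n + 1) := ⟨n, h1, h2⟩
    have e : Nat.find h' = n := by
      obtain ⟨h3, h4⟩ := Nat.find_spec h'
      rcases lt_trichotomy (Nat.find h') n with h | h | h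
      · exact absurd (h4.trans_le ((jumpTime_mono h).trans h1)) (lt_irrefl _)
      · exact h
      · exact absurd (h2.trans_le ((jumpTime_mono h).trans h3)) (lt_irrefl _)
    unfold process
    rw [dif_pos h', e]

lemma process_jumpTime (hG : ∀ a, G.exitRate a ≠ 0) (hω : ∀ n, 0 < ω.2 n) (n : ℕ) :
    G.process (G.jumpTime ω n).toNNReal ω = some (ω.1 n) := by
  refine (process_eq_some_iff _ _).2 ⟨n, ?_, ?_, rfl⟩
  · rw [ENNReal.coe_toNNReal (jumpTime_ne_top hG n)]
  · rw [ENNReal.coe_toNNReal (jumpTime_ne_top hG n)]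
    exact jumpTime_lt_succ hG hω n

/-- The process enters `B` when its jump chain does. -/
lemma sInf_process_mem (hG : ∀ a, G.exitRate a ≠ 0) (hω : ∀ n, 0 < ω.2 n) {B : Set S} {n : ℕ}
    (hn : ω.1 n ∈ B) (hlt : ∀ m < n, ω.1 m ∉ B) :
    sInf ((fun t : ℝ≥0 => (t : ℝ≥0∞)) '' {t : ℝ≥0 | ∃ a, G.process t ω = some a ∧ a ∈ B}) =
      G.jumpTime ω n := by
  refine le_antisymm (sInf_le ⟨(G.jumpTime ω n).toNNReal, ⟨_, process_jumpTime hG hω n, hn⟩,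
    ENNReal.coe_toNNReal (jumpTime_ne_top hG n)⟩) (le_sInf ?_)
  rintro _ ⟨t, ⟨a, ha, haB⟩, rfl⟩
  obtain ⟨m, h1, -, rfl⟩ := (process_eq_some_iff t a).1 ha
  exact (jumpTime_mono (not_lt.1 fun h => hlt m h haB)).trans h1

/-- Jump times are finite and strictly increasing, so the process shows every state of the jump
chain; a possible explosion comes after all of them. -/
lemma firstEntrance_iff (hG : ∀ a, G.exitRate a ≠ 0) (hω : ∀ n, 0 < ω.2 n) {B : Set S} {b : S}
    (hb : b ∈ B) :
    (∃ t : ℝ≥0, (t : ℝ≥0∞) = sInf ((fun t : ℝ≥0 => (t : ℝ≥0∞)) ''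
        {t : ℝ≥0 | ∃ a, G.process t ω = some a ∧ a ∈ B}) ∧ G.process t ω = some b) ↔
      ∃ n, ω.1 n = b ∧ ∀ m < n, ω.1 m ∈ Bᶜ := by
  classical
  constructor
  · rintro ⟨t, ht, hp⟩
    -- Being in `b` at a finite time shows that the jump chain visits `B` at all.
    obtain ⟨m, -, -, hm⟩ := (process_eq_some_iff t b).1 hp
    have hex : ∃ n, ω.1 n ∈ B := ⟨m, hm ▸ hb⟩
    have hmin : ∀ m < Nat.find hex, ω.1 m ∉ B := fun m hm => Nat.find_min hex hm
    rw [sInf_process_mem hG hω (Nat.find_spec hex) hmin] at ht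
    refine ⟨Nat.find hex, ?_, hmin⟩
    have h := process_jumpTime hG hω (Nat.find hex)
    rw [← ht, ENNReal.toNNReal_coe, hp] at h
    exact (Option.some.inj h).symm
  · rintro ⟨n, rfl, hlt⟩
    refine ⟨(G.jumpTime ω n).toNNReal, ?_, process_jumpTime hG hω n⟩
    rw [sInf_process_mem hG hω hb hlt, ENNReal.coe_toNNReal (jumpTime_ne_top hG n)]

end Path

lemma expMeasure_Iic_zero : expMeasure 1 (Set.Iic 0) = 0 := by
  have : IsProbabilityMeasure (expMeasure 1) := isProbabilityMeasure_expMeasure one_pos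
  have h := cdf_expMeasure_eq one_pos 0
  rw [cdf_eq_real] at h
  simpa [measureReal_def, ENNReal.toReal_eq_zero_iff] using h

variable [MeasurableSpace S] [DiscreteMeasurableSpace S] [Countable S]

lemma ae_clock_pos (s : S) : ∀ᵐ ω ∂G.law s, ∀ n, 0 < ω.2 n := by
  have : IsProbabilityMeasure (expMeasure 1) := isProbabilityMeasure_expMeasure one_pos
  have h : ∀ᵐ c ∂(Measure.infinitePi fun _ : ℕ => expMeasure 1), ∀ n, 0 < c n := by
    refine ae_all_iff.2 fun n => ?_
    have hq := measurePreserving_eval_infinitePi (fun _ : ℕ => expMeasure 1) n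
    refine hq.quasiMeasurePreserving.ae (p := fun x : ℝ => 0 < x) ?_
    rw [ae_iff]
    simpa [Set.Iic_def] using expMeasure_Iic_zero
  exact Measure.quasiMeasurePreserving_snd.ae h

/-- The probability that the process enters `B` in the state `b`. -/
lemma law_firstEntrance (hG : ∀ a, G.exitRate a ≠ 0) (s : S) {B : Set S} {b : S} (hb : b ∈ B) :
    G.law s {ω | ∃ t : ℝ≥0, (t : ℝ≥0∞) = sInf ((fun t : ℝ≥0 => (t : ℝ≥0∞)) ''
        {t : ℝ≥0 | ∃ a, G.process t ω = some a ∧ a ∈ B}) ∧ G.process t ω = some b} =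
      potential Bᶜ G.jumpProb s b := by
  have : IsProbabilityMeasure (expMeasure 1) := isProbabilityMeasure_expMeasure one_pos
  rw [← G.jumpChainLaw_firstEntrance s (A := Bᶜ) (u := b) (by simpa using hb)]
  have h : {ω | ∃ t : ℝ≥0, (t : ℝ≥0∞) = sInf ((fun t : ℝ≥0 => (t : ℝ≥0∞)) ''
        {t : ℝ≥0 | ∃ a, G.process t ω = some a ∧ a ∈ B}) ∧ G.process t ω = some b} =ᵐ[G.law s]
      {x : ℕ → S | ∃ n, x n = b ∧ ∀ m < n, x m ∈ Bᶜ} ×ˢ (Set.univ : Set (ℕ → ℝ)) := by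
    refine Filter.eventuallyEq_set.2 ?_
    filter_upwards [G.ae_clock_pos s] with ω hω
    have := firstEntrance_iff hG hω hb
    simpa using this
  rw [measure_congr h, law, Measure.prod_prod, measure_univ, mul_one]

end CTGenerator

/-! ### Vanishing of potentials across a set that cannot be left. -/

section SkipFree

lemma potential_eq_zero {S : Type*} {q : S → S → ℝ≥0∞} {A T : Set S}
    (hT : ∀ s ∈ A, s ∈ T → ∀ u ∉ T, q s u = 0) {s t : S} (hs : s ∈ T) (ht : t ∉ T) :
    potential A q s t = 0 := by
  classical
  -- The function `0` on `T` and `∞` elsewhere is a supersolution, because no weight leaves `T`.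
  have h : potential A q s t ≤ if s ∈ T then 0 else ∞ := by
    refine potential_le (g := fun s => if s ∈ T then 0 else ∞) (fun s => ?_) s
    by_cases hs : s ∈ T
    · have hst : s ≠ t := fun h => ht (h ▸ hs)
      rw [if_neg hst, if_pos hs, zero_add]
      refine le_of_eq (ENNReal.tsum_eq_zero.2 fun u => ?_)
      by_cases hu : u ∈ T
      · simp [hu]
      · by_cases hA : s ∈ A
        · rw [rowRestrict_of_mem hA, hT s hA hs u hu, zero_mul]
        · rw [rowRestrict_of_notMem hA, zero_mul]
    · simp [hs]
  simpa [hs] using h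

end SkipFree

/-! ### The free jump chain and its ladder matrices. -/

namespace QBD

variable {Φ : Type*} (X : QBD Φ)

/-- The jump chain of the doubly infinite process. -/
def freeJumpProb (a b : ℤ × Φ) : ℝ≥0∞ :=
  if a.1 - 1 ≤ b.1 ∧ b.1 ≤ a.1 + 1 then
    X.generator.jumpProb (1, a.2) ((b.1 - a.1 + 1).toNat, b.2) else 0

lemma freeJumpProb_add (c : ℤ) (a b : ℤ × Φ) :
    X.freeJumpProb (a.1 + c, a.2) (b.1 + c, b.2) = X.freeJumpProb a b := by
  simp only [freeJumpProb]
  have h1 : b.1 + c - (a.1 + c) = b.1 - a.1 := by ring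
  have h2 : (a.1 + c - 1 ≤ b.1 + c ∧ b.1 + c ≤ a.1 + c + 1) ↔ (a.1 - 1 ≤ b.1 ∧ b.1 ≤ a.1 + 1) := by
    constructor <;> rintro ⟨h, h'⟩ <;> constructor <;> linarith
  simp only [h1, h2]

lemma freeJumpProb_of_lt {a b : ℤ × Φ} (h : a.1 + 1 < b.1) : X.freeJumpProb a b = 0 :=
  if_neg fun h' => absurd h'.2 (not_le.2 h)

lemma exitRate_of_pos {k : ℕ} (hk : 0 < k) (i : Φ) :
    X.generator.exitRate (k, i) = X.generator.exitRate (1, i) := by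
  simp [CTGenerator.exitRate, X.rate_eq, hk.ne']

/-- Rows at positive levels are translates of the row at level `1`, from which `freeJumpProb` is
read off; level `0` has its own block `Q1b`. -/
lemma jumpProb_of_pos {k : ℕ} (hk : 0 < k) (l : ℕ) (i j : Φ) :
    X.generator.jumpProb (k, i) (l, j) = X.freeJumpProb (k, i) (l, j) := by
  classical
  unfold freeJumpProb
  split_ifs with h
  · simp only at h
    have e : (((l : ℤ) - (k : ℤ) + 1).toNat) + k = l + 1 := by omega
    generalize (((l : ℤ) - (k : ℤ) + 1).toNat) = m at e
    have hl : l = m + k - 1 := by omega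
    have hmk : ((l, j) : ℕ × Φ) = (k, i) ↔ ((m, j) : ℕ × Φ) = (1, i) := by
      simp only [Prod.mk.injEq]
      constructor <;> rintro ⟨h1, h2⟩ <;> exact ⟨by omega, h2⟩
    have hr : X.generator.rate (k, i) (l, j) = X.generator.rate (1, i) (m, j) := by
      rw [X.rate_eq, X.rate_eq]
      have h1 : l = k + 1 ↔ m = 1 + 1 := by omega
      have h2 : l = k ↔ m = 1 := by omega
      have h3 : k = l + 1 ↔ 1 = m + 1 := by omega
      simp only [h1, h2, h3, hk.ne', one_ne_zero]
    simp only [CTGenerator.jumpProb, X.exitRate_of_pos hk, hr, hmk]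
    congr
  · simp only at h
    have hr : X.generator.rate (k, i) (l, j) = 0 := by
      rw [X.rate_eq, if_neg (by omega), if_neg (by omega), if_neg (by omega)]
    have hne : ((l, j) : ℕ × Φ) ≠ (k, i) := by
      simp only [ne_eq, Prod.mk.injEq]
      omega
    simp [CTGenerator.jumpProb, hr, hne]

/-- The potential of the doubly infinite jump chain killed outside the levels in `L`. -/
def levelPotential (L : Set ℤ) (s t : ℤ × Φ) : ℝ≥0∞ :=
  potential {s | s.1 ∈ L} X.freeJumpProb s t

lemma levelPotential_mono {L L' : Set ℤ} (h : L ⊆ L') (s t : ℤ × Φ) :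
    X.levelPotential L s t ≤ X.levelPotential L' s t :=
  potential_mono (A := {s : ℤ × Φ | s.1 ∈ L}) (fun _ hs => h hs) s t

lemma levelPotential_add (c : ℤ) {L L' : Set ℤ} (h : ∀ a, a + c ∈ L' ↔ a ∈ L) (a b : ℤ)
    (i j : Φ) :
    X.levelPotential L' (a + c, i) (b + c, j) = X.levelPotential L (a, i) (b, j) := by
  have hf : Function.Bijective fun s : ℤ × Φ => (s.1 + c, s.2) := by
    refine ⟨fun s t h => ?_, fun s => ⟨(s.1 - c, s.2), by simp⟩⟩
    simpa [Prod.ext_iff] using h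
  exact potential_comp_injective hf.1 (fun s => h s.1) (fun s _ t => X.freeJumpProb_add c s t)
    (fun s _ t ht => absurd (hf.2 t) ht) (a, i) (b, j)

lemma levelPotential_of_lt {L : Set ℤ} {K : ℤ} (hL : ∀ a ∈ L, a < K) {s t : ℤ × Φ} (hs : s.1 ≤ K)
    (ht : K < t.1) : X.levelPotential L s t = 0 := by
  refine potential_eq_zero (T := {s | s.1 ≤ K}) (fun s hsL _ u hu => ?_)
    (by simpa using hs) (by simpa using ht)
  have h1 : s.1 < K := hL _ hsL
  have h2 : K < u.1 := by simpa using hu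
  exact X.freeJumpProb_of_lt (by omega)

/-- Starting from level `0` and phase `i`, the probability that the doubly infinite jump chain
enters the level `n` in the phase `j`. -/
def ladder (n : ℕ) (i j : Φ) : ℝ≥0∞ := X.levelPotential (Set.Iio n) (0, i) (n, j)

open Classical in
lemma ladder_zero (i j : Φ) : X.ladder 0 i j = if i = j then 1 else 0 := by
  unfold ladder levelPotential
  rw [potential_of_notMem (by simp)]
  simp

/-- The path is split at its first exit from the levels below `m`. By skip-freeness the exit is at
level `m` exactly, and translation identifies the remaining climb. -/
lemma ladder_add (m n : ℕ) (i j : Φ) :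
    X.ladder (m + n) i j = ∑' l, X.ladder m i l * X.ladder n l j := by
  have h1 : ({s | s.1 ∈ Set.Iio (m : ℤ)} : Set (ℤ × Φ)) ⊆
      {s | s.1 ∈ Set.Iio (((m + n : ℕ)) : ℤ)} := by
    intro s hs
    simp only [Set.mem_ofPred_eq, Set.mem_Iio] at hs ⊢
    omega
  unfold ladder
  rw [levelPotential, potential_eq_tsum_exit h1 (by simp)]
  have hinj : Function.Injective fun l : Φ => ((m : ℤ), l) := fun _ _ h => (Prod.ext_iff.1 h).2
  rw [← hinj.tsum_eq]
  · refine tsum_congr fun l => ?_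
    rw [Set.indicator_of_mem (by simp)]
    have := X.levelPotential_add m (L := Set.Iio (n : ℤ)) (L' := Set.Iio ((m + n : ℕ) : ℤ))
      (fun a => by simp only [Set.mem_Iio]; omega) 0 n l j
    rw [← this, zero_add, show (n : ℤ) + m = ((m + n : ℕ) : ℤ) by push_cast; ring]
    rfl
  · rintro ⟨a, l⟩ hal
    rw [Function.mem_support] at hal
    rcases lt_trichotomy a m with h | rfl | h
    · exact absurd (by simp [h]) hal
    · exact ⟨l, rfl⟩
    · refine absurd ?_ hal
      have : potential {s | s.1 ∈ Set.Iio (m : ℤ)} X.freeJumpProb (0, i) (a, l) = 0 :=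
        X.levelPotential_of_lt (K := m) (fun b hb => hb) (by simp) h
      rw [this, zero_mul]

lemma nnPow_ladder_one (n : ℕ) (i j : Φ) : nnPow (X.ladder 1) n i j = X.ladder n i j := by
  induction n generalizing j with
  | zero => rw [ladder_zero]; rfl
  | succ n ih =>
    rw [ladder_add]
    simp_rw [← ih]
    rfl

lemma exitRate_ne_zero (hirr : X.Irreducible) (a : ℕ × Φ) : X.generator.exitRate a ≠ 0 := by
  classical
  intro h
  have h0 : ∀ b, a ≠ b → ¬ 0 < X.generator.rate a b := by
    intro b hab hpos
    have := ((X.generator.hasSum_off_diag a)).tsum_eq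
    have hle := (X.generator.hasSum_off_diag a).summable.le_tsum b (fun c hc => by
      by_cases hca : c = a
      · simp [hca]
      · simpa [hca] using X.generator.rate_nonneg a c (Ne.symm hca))
    rw [this, h, if_neg (Ne.symm hab)] at hle
    linarith
  rcases (Relation.ReflTransGen.cases_head (hirr a (a.1 + 1, a.2))) with h1 | ⟨b, hb, -⟩
  · have := (Prod.ext_iff.1 h1).1
    simp at this
  · exact h0 b hb.1 hb.2

lemma freeJumpProb_ne_zero (hirr : X.Irreducible) {a b : ℤ × Φ} (hab : a ≠ b)
    (h : 0 < X.doublyInfiniteRate a b) : X.freeJumpProb a b ≠ 0 := by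
  classical
  obtain ⟨a, i⟩ := a
  obtain ⟨b, j⟩ := b
  have hex := X.exitRate_ne_zero hirr (1, i)
  have hpos : 0 < X.generator.exitRate (1, i) := (X.generator.exitRate_nonneg _).lt_of_ne' hex
  unfold doublyInfiniteRate at h
  simp only at h
  have hab' : a - 1 ≤ b ∧ b ≤ a + 1 := by
    by_contra hc
    rw [if_neg (by omega), if_neg (by omega), if_neg (by omega)] at h
    exact lt_irrefl _ h
  unfold freeJumpProb
  rw [if_pos hab']
  simp only
  obtain ⟨m, hm⟩ : ∃ m : ℕ, (m : ℤ) = b - a + 1 := ⟨(b - a + 1).toNat, by omega⟩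
  rw [← hm, Int.toNat_natCast]
  have hr : X.generator.rate (1, i) (m, j) =
      if b = a + 1 then X.Q0 i j else if b = a then X.Q1 i j
        else if a = b + 1 then X.Q2 i j else 0 := by
    rw [X.rate_eq]
    have h1 : m = 1 + 1 ↔ b = a + 1 := by omega
    have h2 : m = 1 ↔ b = a := by omega
    have h3 : 1 = m + 1 ↔ a = b + 1 := by omega
    simp only [h1, h2, h3, one_ne_zero, if_false]
  have hne : ((m, j) : ℕ × Φ) ≠ (1, i) := by
    intro he
    obtain ⟨he1, he2⟩ := Prod.ext_iff.1 he
    simp only at he1 he2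
    exact hab (Prod.ext (by simp only; omega) he2.symm)
  rw [CTGenerator.jumpProb, if_neg hex, if_neg hne, hr]
  exact (ENNReal.ofReal_pos.2 (div_pos h hpos)).ne'

/-- A path of the doubly infinite chain bounds the potentials from below, uniformly over the
half-lines which contain it. -/
lemma exists_mul_levelPotential_le (hirr : X.Irreducible) {s u : ℤ × Φ}
    (h : Relation.ReflTransGen (fun x y => x ≠ y ∧ 0 < X.doublyInfiniteRate x y) s u) :
    ∃ M : ℤ, ∃ p : ℝ≥0∞, p ≠ 0 ∧ ∀ N ≥ M, ∀ t,
      p * X.levelPotential (Set.Iio N) u t ≤ X.levelPotential (Set.Iio N) s t := by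
  induction h using Relation.ReflTransGen.head_induction_on with
  | refl => exact ⟨0, 1, one_ne_zero, fun N _ t => by rw [one_mul]⟩
  | @head a c hab _ ih =>
    obtain ⟨M, p, hp, hM⟩ := ih
    -- `N ≥ a.1 + 1` keeps the starting state of the step inside the half-line.
    refine ⟨max M (a.1 + 1), X.freeJumpProb a c * p,
      mul_ne_zero (X.freeJumpProb_ne_zero hirr hab.1 hab.2) hp, fun N hN t => ?_⟩
    rw [mul_assoc]
    refine (mul_le_mul' le_rfl (hM N ((le_max_left _ _).trans hN) t)).trans ?_
    refine mul_potential_le ?_ c t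
    have := (le_max_right _ _).trans hN
    simp only [Set.mem_ofPred_eq, Set.mem_Iio]
    omega

/-- Once the path has led to `(a, j)`, the climb to level `N` is, after translation, a climb of `n =
N - a` levels. -/
lemma exists_mul_ladder_le (hirr : X.Irreducible) (hcond : X.DoublyInfiniteIrreducible) (i j : Φ)
    (a : ℤ) : ∃ M : ℕ, ∃ p : ℝ≥0∞, p ≠ 0 ∧ ∀ N ≥ M, ∀ n : ℕ, (n : ℤ) + a = N →
      ∀ l, p * X.ladder n j l ≤ X.ladder N i l := by
  obtain ⟨M, p, hp, hM⟩ := X.exists_mul_levelPotential_le hirr (hcond (0, i) (a, j))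
  refine ⟨M.toNat, p, hp, fun N hN n hn l => ?_⟩
  have h := hM N (by omega) (N, l)
  have e := X.levelPotential_add a (L := Set.Iio (n : ℤ)) (L' := Set.Iio (N : ℤ))
      (fun a => by simp only [Set.mem_Iio]; omega) 0 n j l
  rw [zero_add, hn] at e
  rwa [e] at h

/-- A path from `(0, i)` to `(1, i)` must leave the levels below `1`, and can do so only at level
`1`. -/
lemma exists_ladder_one_ne_zero (hirr : X.Irreducible) (hcond : X.DoublyInfiniteIrreducible)
    (i : Φ) : ∃ l, X.ladder 1 i l ≠ 0 := by
  classical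
  have hpath : ∀ {s u : ℤ × Φ}, Relation.ReflTransGen
      (fun x y => x ≠ y ∧ 0 < X.doublyInfiniteRate x y) s u →
      X.levelPotential Set.univ s u ≠ 0 := by
    intro s u h
    induction h using Relation.ReflTransGen.head_induction_on with
    | refl =>
      unfold levelPotential
      rw [potential_eq]
      simp
    | @head a c hab _ ih =>
      intro h0
      have := mul_potential_le (q := X.freeJumpProb) (A := {s : ℤ × Φ | s.1 ∈ Set.univ})
        (s := a) (by simp) c u
      unfold levelPotential at h0 ih
      rw [h0, le_zero_iff, mul_eq_zero] at this
      exact this.elim (X.freeJumpProb_ne_zero hirr hab.1 hab.2) ih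
  have h := hpath (hcond (0, i) (1, i))
  unfold levelPotential at h
  rw [potential_eq_tsum_exit (A := {s : ℤ × Φ | s.1 ∈ Set.Iio 1}) (fun s _ => by simp)
    (by simp)] at h
  obtain ⟨u, hu⟩ := not_forall.1 (mt ENNReal.tsum_eq_zero.2 h)
  rw [mul_eq_zero, not_or] at hu
  have hu1 : 1 ≤ u.1 := by
    by_contra hc
    exact hu.2 (Set.indicator_of_notMem (by simpa using hc) _)
  have hu2 : u.1 ≤ 1 := by
    by_contra hc
    exact hu.1 (X.levelPotential_of_lt (K := 1) (fun a ha => ha) (by simp) (by simpa using hc))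
  refine ⟨u.2, ?_⟩
  have : u = (((1 : ℕ) : ℤ), u.2) := Prod.ext (by simp only [Nat.cast_one]; omega) rfl
  rw [this] at hu
  exact hu.1

/-! ### Hitting probabilities as potentials of the free chain. -/

section HitProb

variable [MeasurableSpace Φ] [DiscreteMeasurableSpace Φ] [Countable Φ]

lemma hitProb_eq_levelPotential (hirr : X.Irreducible) {k K : ℕ} (hk : k ≤ K) (i j : Φ) :
    X.hitProb k K i j = X.levelPotential (Set.Ioo 0 K) (k, i) (K, j) := by
  classical
  have h := X.generator.law_firstEntrance (X.exitRate_ne_zero hirr) (k, i)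
    (B := {s | s.1 = 0 ∨ s.1 = K}) (b := (K, j)) (by simp)
  have hinj : Function.Injective fun s : ℕ × Φ => ((s.1 : ℤ), s.2) := fun s t hst => by
    simpa [Prod.ext_iff] using hst
  have h2 := potential_comp_injective hinj (q := X.generator.jumpProb) (q' := X.freeJumpProb)
    (A := {s | s.1 = 0 ∨ s.1 = K}ᶜ) (A' := {s | 0 < s.1 ∧ s.1 ≠ (K : ℤ)}) (fun s => by simp; omega)
    (fun s hs t => (X.jumpProb_of_pos (by simp at hs; omega) _ _ _).symm)
    (fun s hs t ht => by
      refine if_neg fun hc => ht ⟨(t.1.toNat, t.2), ?_⟩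
      simp only [Set.mem_compl_iff, Set.mem_ofPred_eq] at hs
      refine Prod.ext ?_ rfl
      simp only at hc ⊢
      omega) (k, i) (K, j)
  have h3 : X.hitProb k K i j = potential {s | 0 < s.1 ∧ s.1 ≠ (K : ℤ)} X.freeJumpProb (k, i) (K, j) :=
    h.trans h2.symm
  -- The complement of levels `0` and `K` also contains the levels above `K`. Splitting at the exit
  -- from the open strip removes them: from `k ≤ K` they are not reached, and every other exit state
  -- is already stopped.
  rw [h3, potential_eq_tsum_exit (A := {s | s.1 ∈ Set.Ioo (0 : ℤ) K})
    (fun s hs => by simp at hs ⊢; omega) (by simp)]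
  have hK : (((K : ℤ), j) : ℤ × Φ) ∉ {s : ℤ × Φ | s.1 ∈ Set.Ioo (0 : ℤ) K} := by simp
  rw [tsum_eq_single ((K : ℤ), j)]
  · have e : potential {s | 0 < s.1 ∧ s.1 ≠ (K : ℤ)} X.freeJumpProb (K, j) (K, j) = 1 := by
      rw [potential_of_notMem (by simp), if_pos rfl]
    rw [Set.indicator_of_mem (by exact hK), e, mul_one]
    rfl
  · intro u hu
    by_cases huA : u ∈ {s : ℤ × Φ | s.1 ∈ Set.Ioo (0 : ℤ) K}
    · rw [Set.indicator_of_notMem (by simpa using huA), mul_zero]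
    · by_cases huK : (K : ℤ) < u.1
      · have : potential {s | s.1 ∈ Set.Ioo (0 : ℤ) K} X.freeJumpProb (k, i) u = 0 :=
          X.levelPotential_of_lt (K := K) (fun a ha => ha.2) (by simpa using hk) huK
        rw [this, zero_mul]
      · have hu0 : u ∉ {s : ℤ × Φ | 0 < s.1 ∧ s.1 ≠ (K : ℤ)} := by
          simp only [Set.mem_ofPred_eq, Set.mem_Ioo] at huA ⊢
          omega
        rw [Set.indicator_of_mem (by exact huA), potential_of_notMem hu0, if_neg hu, mul_zero]

lemma hitProb_eq_levelPotential_Ioo (hirr : X.Irreducible) (k n : ℕ) (i j : Φ) :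
    X.hitProb k (k + n) i j = X.levelPotential (Set.Ioo (-k) n) (0, i) (n, j) := by
  rw [X.hitProb_eq_levelPotential hirr (Nat.le_add_right k n)]
  have := X.levelPotential_add k (L := Set.Ioo (-(k : ℤ)) n) (L' := Set.Ioo 0 ((k + n : ℕ) : ℤ))
    (fun a => by simp only [Set.mem_Ioo]; omega) 0 n i j
  rw [← this, zero_add, Nat.cast_add, add_comm (k : ℤ)]

lemma hitProb_le_one (k K : ℕ) (i j : Φ) : X.hitProb k K i j ≤ 1 := prob_le_one

lemma hitProb_add_mono (hirr : X.Irreducible) (n : ℕ) (i j : Φ) :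
    Monotone fun k => X.hitProb k (k + n) i j := by
  intro k l hkl
  simp only [X.hitProb_eq_levelPotential_Ioo hirr]
  exact X.levelPotential_mono (Set.Ioo_subset_Ioo_left (by omega)) _ _

/-- With the start moved to level `0`, the lower barrier is at `-k` and recedes as `k` grows. -/
lemma ladder_eq_iSup (hirr : X.Irreducible) (n : ℕ) (i j : Φ) :
    X.ladder n i j = ⨆ k, X.hitProb k (k + n) i j := by
  simp only [X.hitProb_eq_levelPotential_Ioo hirr]
  unfold ladder levelPotential
  rw [← potential_iUnion]
  · congr 1
    ext s
    simp only [Set.mem_ofPred_eq, Set.mem_Iio, Set.mem_iUnion, Set.mem_Ioo]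
    exact ⟨fun h => ⟨s.1.natAbs + 1, by omega, h⟩, fun ⟨_, _, h⟩ => h⟩
  · intro k l hkl s hs
    simp only [Set.mem_ofPred_eq, Set.mem_Ioo] at hs ⊢
    omega

lemma H_eq_ladder (hirr : X.Irreducible) : X.H = X.ladder 1 := by
  ext i j
  exact (X.ladder_eq_iSup hirr 1 i j).symm

lemma hitProb_mul_le (hirr : X.Irreducible) {k K M : ℕ} (h1 : k ≤ K) (h2 : K ≤ M) (i l j : Φ) :
    X.hitProb k K i l * X.hitProb K M l j ≤ X.hitProb k M i j := by
  rw [X.hitProb_eq_levelPotential hirr h1, X.hitProb_eq_levelPotential hirr h2,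
    X.hitProb_eq_levelPotential hirr (h1.trans h2)]
  refine potential_mul_le (fun s hs => ?_) (by simp; omega) (by simp) _
  simp only [Set.mem_ofPred_eq, Set.mem_Ioo] at hs ⊢
  omega

end HitProb

end QBD

/-! ### Primitive decompositions -/

section Decomposition

variable {ι : Type*}

/-- The rows of the powers of `A` are comparable, up to any shift of the exponent. -/
def ShiftComparable (A : ι → ι → ℝ≥0∞) : Prop :=
  ∀ (i j : ι) (a : ℤ), ∃ M : ℕ, ∃ p : ℝ≥0∞, p ≠ 0 ∧ ∀ N ≥ M, ∀ n : ℕ, (n : ℤ) + a = N →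
    ∀ l, p * nnPow A n j l ≤ nnPow A N i l

/-- The indices which lie on a cycle of `A`. -/
def cyclicIndices (A : ι → ι → ℝ≥0∞) : Set ι := {j | ∃ n, 0 < n ∧ nnPow A n j j ≠ 0}

variable {A : ι → ι → ℝ≥0∞}

lemma nnPow_mul_self_ne_zero {n : ℕ} {j : ι} (h : nnPow A n j j ≠ 0) (p : ℕ) :
    nnPow A (p * n) j j ≠ 0 := by
  induction p with
  | zero => simp [nnPow_zero_self]
  | succ p ih =>
    rw [Nat.succ_mul]
    exact nnPow_add_ne_zero ih h

namespace ShiftComparable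

lemma exists_ne_zero (hA : ShiftComparable A) (i j : ι) (a : ℤ) : ∃ M : ℕ, ∀ N ≥ M, ∀ n : ℕ,
    (n : ℤ) + a = N → ∀ l, nnPow A n j l ≠ 0 → nnPow A N i l ≠ 0 := by
  obtain ⟨M, p, hp, hM⟩ := hA i j a
  exact ⟨M, fun N hN n hn l hl h0 =>
    mul_ne_zero hp hl (le_zero_iff.1 (h0 ▸ hM N hN n hn l))⟩

/-- A cycle of length `n` at `j` covers the multiples of `n`; the shifts `0, ..., n - 1` supply the
other residues. -/
lemma eventually_nnPow_ne_zero (hA : ShiftComparable A) {j : ι} (hj : j ∈ cyclicIndices A)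
    (i : ι) : ∀ᶠ m in atTop, nnPow A m i j ≠ 0 := by
  obtain ⟨n, hn, hjj⟩ := hj
  choose M hM using fun r : ℕ => hA.exists_ne_zero i j (r : ℤ)
  refine eventually_atTop.2 ⟨(Finset.range n).sup M, fun N hN => ?_⟩
  have hr := N.mod_lt hn
  refine hM (N % n) N ((Finset.le_sup (Finset.mem_range.2 hr)).trans hN) (N / n * n) ?_ j
    (nnPow_mul_self_ne_zero hjj _)
  have := Nat.div_add_mod N n
  rw [mul_comm] at this
  exact_mod_cast this

/-- Comparing row `i` with itself under the shift `1` makes supports increase from time `M` on. An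
index `j` reached at time `M` is thus reached at all later times, and comparing row `j` with row `i`
closes a cycle at `j`. -/
lemma cyclicIndices_nonempty [Nonempty ι] (hA : ShiftComparable A)
    (hrow : ∀ i, ∃ l, A i l ≠ 0) : (cyclicIndices A).Nonempty := by
  have hrows : ∀ n i, ∃ l, nnPow A n i l ≠ 0 := by
    intro n
    induction n with
    | zero => exact fun i => ⟨i, by simp [nnPow_zero_self]⟩
    | succ n ih =>
      intro i
      obtain ⟨l, hl⟩ := ih i
      obtain ⟨m, hm⟩ := hrow l
      exact ⟨m, nnPow_add_ne_zero hl (by rwa [nnPow_one])⟩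
  obtain ⟨i⟩ := ‹Nonempty ι›
  obtain ⟨M, hM⟩ := hA.exists_ne_zero i i 1
  obtain ⟨j, hj⟩ := hrows M i
  have hall : ∀ n ≥ M, nnPow A n i j ≠ 0 := by
    intro n hn
    induction n, hn using Nat.le_induction with
    | base => exact hj
    | succ n hn ih => exact hM (n + 1) (hn.trans n.le_succ) n (by push_cast; ring) j ih
  obtain ⟨M', hM'⟩ := hA.exists_ne_zero j i 0
  exact ⟨j, M + M' + 1, by omega, hM' _ (by omega) (M + M' + 1) (by simp) j
    (hall _ (by omega))⟩

lemma mem_cyclicIndices_of_ne_zero (hA : ShiftComparable A) {n : ℕ} {i j : ι}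
    (hi : i ∈ cyclicIndices A) (h : nnPow A n i j ≠ 0) : j ∈ cyclicIndices A := by
  obtain ⟨m, hm, hm0⟩ := ((hA.eventually_nnPow_ne_zero hi j).and (eventually_gt_atTop 0)).exists
  exact ⟨m + n, by omega, nnPow_add_ne_zero hm h⟩

/-- Row `c` of a cyclic index charges only cyclic indices, and it dominates row `i`; so `M` serves
all `l` at once. -/
lemma eventually_nnPow_eq_zero (hA : ShiftComparable A) (hC : (cyclicIndices A).Nonempty) (i : ι) :
    ∃ M : ℕ, ∀ N ≥ M, ∀ l ∉ cyclicIndices A, nnPow A N i l = 0 := by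
  obtain ⟨c, hc⟩ := hC
  obtain ⟨M, hM⟩ := hA.exists_ne_zero c i 0
  refine ⟨M, fun N hN l hl => ?_⟩
  by_contra h
  exact hl (hA.mem_cyclicIndices_of_ne_zero hc (hM N hN N (by simp) l h))

end ShiftComparable

lemma nnPow_diagBlock {C : Set ι} (h : ∀ i ∈ C, ∀ j ∉ C, A i j = 0) (n : ℕ) (i j : C) :
    nnPow (diagBlock A C) n i j = nnPow A n i j :=
  (nnPow_comp_injective Subtype.val_injective (fun _ _ => rfl)
    (fun i k hk => h i i.2 k (by simpa using hk)) n i j).symm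

lemma nnPow_eq_zero_of_closed {C : Set ι} (h : ∀ i ∈ C, ∀ j ∉ C, A i j = 0) (n : ℕ) {i j : ι}
    (hi : i ∈ C) (hj : j ∉ C) : nnPow A n i j = 0 := by
  induction n generalizing j with
  | zero =>
    have : i ≠ j := fun e => hj (e ▸ hi)
    simp [nnPow, this]
  | succ n ih =>
    refine ENNReal.tsum_eq_zero.2 fun l => ?_
    by_cases hl : l ∈ C
    · rw [h l hl j hj, mul_zero]
    · rw [ih hl, zero_mul]

namespace ShiftComparable

lemma isPrimitiveDecomposition [Nonempty ι] (hA : ShiftComparable A)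
    (hrow : ∀ i, ∃ l, A i l ≠ 0) : IsPrimitiveDecomposition A (cyclicIndices A) := by
  classical
  have hne := hA.cyclicIndices_nonempty hrow
  have hclosed : ∀ i ∈ cyclicIndices A, ∀ j ∉ cyclicIndices A, A i j = 0 := by
    intro i hi j hj
    by_contra h
    exact hj (hA.mem_cyclicIndices_of_ne_zero (n := 1) hi (by rwa [nnPow_one]))
  refine ⟨hne, fun i j => ?_, fun i d hd => ?_, hclosed, ?_⟩
  · obtain ⟨m, hm, hm0⟩ := ((hA.eventually_nnPow_ne_zero j.2 i).and
      (eventually_gt_atTop 0)).exists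
    exact ⟨m, hm0, by rw [nnPow_diagBlock hclosed]; exact pos_iff_ne_zero.2 hm⟩
  · obtain ⟨m, hm⟩ := eventually_atTop.1 (hA.eventually_nnPow_ne_zero i.2 i)
    have h1 := hd m (by rw [nnPow_diagBlock hclosed]; exact pos_iff_ne_zero.2 (hm m le_rfl))
    have h2 := hd (m + 1) (by
      rw [nnPow_diagBlock hclosed]; exact pos_iff_ne_zero.2 (hm (m + 1) m.le_succ))
    exact Nat.dvd_one.1 ((Nat.dvd_add_right h1).1 h2)
  · have hex := hA.eventually_nnPow_eq_zero hne
    -- The rank is the first time from which the row is supported on cyclic indices. A step of `A`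
    -- uses up one unit of time, so the rank drops; it is positive off the cyclic indices because
    -- the power `0` is the identity.
    refine ⟨fun i => Nat.find (hex i), fun i hi j hj hij => ?_⟩
    have hpos : 0 < Nat.find (hex i) := by
      refine Nat.pos_of_ne_zero fun h0 => ?_
      have := Nat.find_spec (hex i) 0 (by rw [h0]) i hi
      simp [nnPow_zero_self] at this
    have hle : Nat.find (hex j) ≤ Nat.find (hex i) - 1 := by
      refine Nat.find_min' (hex j) fun N hN l hl => ?_
      by_contra h
      have h1 : nnPow A (1 + N) i l ≠ 0 :=
        nnPow_add_ne_zero (by rwa [nnPow_one]) h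
      exact h1 (Nat.find_spec (hex i) (1 + N) (by omega) l hl)
    change Nat.find (hex j) < Nat.find (hex i)
    omega

lemma eq_cyclicIndices (hA : ShiftComparable A) {C : Set ι} (hC : IsPrimitiveDecomposition A C) :
    C = cyclicIndices A := by
  have hsub : C ⊆ cyclicIndices A := by
    intro i hi
    obtain ⟨n, hn, h⟩ := hC.irreducible ⟨i, hi⟩ ⟨i, hi⟩
    rw [nnPow_diagBlock hC.upper_right] at h
    exact ⟨n, hn, h.ne'⟩
  refine Set.Subset.antisymm hsub fun i hi => ?_
  obtain ⟨c, hc⟩ := hC.nonempty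
  obtain ⟨m, hm⟩ := (hA.eventually_nnPow_ne_zero hi c).exists
  by_contra h
  exact hm (nnPow_eq_zero_of_closed hC.upper_right m hc h)

end ShiftComparable

/-! ### The convergence norm -/

lemma tsum_nnPow_ne_top_of_lt {i j : ι} {z : ℝ≥0} (hz : (z : ℝ≥0∞) < entryRadius A i j) :
    ∑' k, nnPow A k i j * (z : ℝ≥0∞) ^ k ≠ ∞ := by
  obtain ⟨⟨w, hw⟩, hzw⟩ := lt_iSup_iff.1 hz
  refine ne_top_of_le_ne_top hw (ENNReal.tsum_le_tsum fun k => ?_)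
  gcongr

lemma le_entryRadius {i j : ι} {z : ℝ≥0} (hz : ∑' k, nnPow A k i j * (z : ℝ≥0∞) ^ k ≠ ∞) :
    (z : ℝ≥0∞) ≤ entryRadius A i j :=
  le_iSup (fun z : {z : ℝ≥0 // ∑' k, nnPow A k i j * (z : ℝ≥0∞) ^ k ≠ ∞} =>
    ((z : ℝ≥0) : ℝ≥0∞)) ⟨z, hz⟩

lemma entryRadius_pos (h1 : ∀ n i j, nnPow A n i j ≤ 1) (i j : ι) : 0 < entryRadius A i j := by
  have h : ∑' k, nnPow A k i j * ((2⁻¹ : ℝ≥0) : ℝ≥0∞) ^ k ≠ ∞ := by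
    refine ne_top_of_le_ne_top (b := ∑' k : ℕ, (2⁻¹ : ℝ≥0∞) ^ k) ?_
      (ENNReal.tsum_le_tsum fun k => ?_)
    · rw [ENNReal.tsum_geometric, ENNReal.one_sub_inv_two, inv_inv]
      exact ENNReal.ofNat_ne_top
    · rw [ENNReal.coe_inv two_ne_zero]
      exact mul_le_of_le_one_left' (h1 k i j)
  refine lt_of_lt_of_le ?_ (le_entryRadius h)
  simp

lemma entryRadius_self_ne_top {j : ι} (hj : j ∈ cyclicIndices A) (h1 : ∀ n, nnPow A n j j ≤ 1) :
    entryRadius A j j ≠ ∞ := by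
  obtain ⟨n, hn, hjj⟩ := hj
  have hε : nnPow A n j j ≠ ∞ := ne_top_of_le_ne_top ENNReal.one_ne_top (h1 n)
  -- The maximum with `1` ensures `z ≤ z ^ n`, which avoids an `n`-th root.
  refine ne_top_of_le_ne_top (b := max 1 (nnPow A n j j)⁻¹) (by simp [hjj]) (iSup_le ?_)
  rintro ⟨z, hz⟩
  by_contra hlt
  rw [not_le, max_lt_iff] at hlt
  refine hz ?_
  have hbase : 1 ≤ nnPow A n j j * (z : ℝ≥0∞) ^ n := by
    calc (1 : ℝ≥0∞) = nnPow A n j j * (nnPow A n j j)⁻¹ := (ENNReal.mul_inv_cancel hjj hε).symm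
      _ ≤ nnPow A n j j * (z : ℝ≥0∞) ^ n := by
        gcongr
        exact hlt.2.le.trans (le_self_pow hlt.1.le hn.ne')
  have hpow : ∀ p, 1 ≤ nnPow A (p * n) j j * (z : ℝ≥0∞) ^ (p * n) := by
    intro p
    induction p with
    | zero => simp [nnPow_zero_self]
    | succ p ih =>
      calc (1 : ℝ≥0∞) ≤ (nnPow A (p * n) j j * (z : ℝ≥0∞) ^ (p * n)) *
            (nnPow A n j j * (z : ℝ≥0∞) ^ n) := one_le_mul ih hbase
        _ = (nnPow A (p * n) j j * nnPow A n j j) * (z : ℝ≥0∞) ^ ((p + 1) * n) := by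
          rw [Nat.succ_mul, pow_add]; ring
        _ ≤ _ := by
          gcongr
          rw [Nat.succ_mul]
          exact nnPow_mul_le A _ _ j j j
  rw [eq_top_iff]
  calc (∞ : ℝ≥0∞) = ∑' _ : ℕ, (1 : ℝ≥0∞) := (ENNReal.tsum_const_eq_top_of_ne_zero one_ne_zero).symm
    _ ≤ ∑' p : ℕ, nnPow A (p * n) j j * (z : ℝ≥0∞) ^ (p * n) := ENNReal.tsum_le_tsum hpow
    _ ≤ _ := ENNReal.tsum_comp_le_tsum_of_injective
      (fun a b h => Nat.eq_of_mul_eq_mul_right hn h) (fun k => nnPow A k j j * (z : ℝ≥0∞) ^ k)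

/-- Otherwise all terms at `w` are at most one, and a geometric series gives convergence at some `z`
strictly between the radius and `w`. -/
lemma exists_one_lt_nnPow_mul_pow {j : ι} {w : ℝ≥0}
    (hw : entryRadius A j j < w) : ∃ n, 0 < n ∧ 1 < nnPow A n j j * (w : ℝ≥0∞) ^ n := by
  by_contra hcon
  push Not at hcon
  obtain ⟨z, hz1, hz2⟩ := ENNReal.lt_iff_exists_nnreal_btwn.1 hw
  have hw0 : (w : ℝ≥0∞) ≠ 0 := (pos_of_gt hw).ne'
  refine hz1.not_ge (le_entryRadius ?_)
  have hle : ∀ k, nnPow A k j j * (z : ℝ≥0∞) ^ k ≤ ((z : ℝ≥0∞) / w) ^ k := by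
    intro k
    rcases Nat.eq_zero_or_pos k with rfl | hk
    · simp [nnPow_zero_self]
    · calc nnPow A k j j * (z : ℝ≥0∞) ^ k
          = nnPow A k j j * (w : ℝ≥0∞) ^ k * ((z : ℝ≥0∞) / w) ^ k := by
            rw [mul_assoc, ← mul_pow, ENNReal.mul_div_cancel hw0 ENNReal.coe_ne_top]
        _ ≤ 1 * ((z : ℝ≥0∞) / w) ^ k := by gcongr; exact hcon k hk
        _ = _ := one_mul _
  refine ne_top_of_le_ne_top ?_ (ENNReal.tsum_le_tsum hle)
  rw [ENNReal.tsum_geometric, ENNReal.inv_ne_top, ne_eq, tsub_eq_zero_iff_le, not_le]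
  exact ENNReal.div_lt_of_lt_mul (by rwa [one_mul])

/-- The shift `0` exchanges row `i'` for row `i`, and a connection of `m` steps from `j'` to `j`
exchanges the column. Up to the factor `q`, a tail of one series is thus below the other. -/
lemma ShiftComparable.tsum_nnPow_ne_top (hA : ShiftComparable A)
    (h1 : ∀ n i j, nnPow A n i j ≤ 1) {j : ι} (hj : j ∈ cyclicIndices A) (i i' j' : ι) {z : ℝ≥0}
    (hz : ∑' k, nnPow A k i j * (z : ℝ≥0∞) ^ k ≠ ∞) :
    ∑' k, nnPow A k i' j' * (z : ℝ≥0∞) ^ k ≠ ∞ := by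
  have hfin : ∀ k, nnPow A k i' j' * (z : ℝ≥0∞) ^ k ≠ ∞ := fun k =>
    ENNReal.mul_ne_top (ne_top_of_le_ne_top ENNReal.one_ne_top (h1 k i' j'))
      (ENNReal.pow_ne_top ENNReal.coe_ne_top)
  rcases eq_or_ne z 0 with rfl | hz0
  · rw [tsum_eq_single 0 (fun k hk => by simp [hk])]
    exact hfin 0
  obtain ⟨M, p, hp, hM⟩ := hA i i' 0
  obtain ⟨m, hm⟩ := (hA.eventually_nnPow_ne_zero hj j').exists
  have hz' : (z : ℝ≥0∞) ≠ 0 := by simpa using hz0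
  set q := p * nnPow A m j' j * (z : ℝ≥0∞) ^ m with hq
  have hq0 : q ≠ 0 := mul_ne_zero (mul_ne_zero hp hm) (pow_ne_zero _ hz')
  have hterm : ∀ N ≥ M, q * (nnPow A N i' j' * (z : ℝ≥0∞) ^ N) ≤
      nnPow A (N + m) i j * (z : ℝ≥0∞) ^ (N + m) := by
    intro N hN
    calc q * (nnPow A N i' j' * (z : ℝ≥0∞) ^ N)
        = (p * nnPow A N i' j') * nnPow A m j' j * (z : ℝ≥0∞) ^ (N + m) := by
          rw [hq, pow_add]; ring
      _ ≤ nnPow A N i j' * nnPow A m j' j * (z : ℝ≥0∞) ^ (N + m) := by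
          gcongr
          exact hM N hN N (by simp) j'
      _ ≤ _ := by
          gcongr
          exact nnPow_mul_le A _ _ _ _ _
  rw [← ENNReal.summable.sum_add_tsum_nat_add' (k := M)]
  refine ENNReal.add_ne_top.2 ⟨ENNReal.sum_ne_top.2 fun k _ => hfin k, fun htop => ?_⟩
  refine hz (eq_top_iff.2 ?_)
  calc (∞ : ℝ≥0∞) = q * ∑' k, nnPow A (k + M) i' j' * (z : ℝ≥0∞) ^ (k + M) := by
        rw [htop, ENNReal.mul_top hq0]
    _ = ∑' k, q * (nnPow A (k + M) i' j' * (z : ℝ≥0∞) ^ (k + M)) := ENNReal.tsum_mul_left.symm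
    _ ≤ ∑' k, nnPow A (k + M + m) i j * (z : ℝ≥0∞) ^ (k + M + m) :=
        ENNReal.tsum_le_tsum fun k => hterm _ (Nat.le_add_left _ _)
    _ ≤ _ := ENNReal.tsum_comp_le_tsum_of_injective (f := fun k => k + M + m)
      (fun a b h => by simpa using h) (fun k => nnPow A k i j * (z : ℝ≥0∞) ^ k)

lemma ShiftComparable.entryRadius_eq (hA : ShiftComparable A) (h1 : ∀ n i j, nnPow A n i j ≤ 1)
    {j j' : ι} (hj : j ∈ cyclicIndices A) (hj' : j' ∈ cyclicIndices A) (i i' : ι) :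
    entryRadius A i j = entryRadius A i' j' :=
  le_antisymm (iSup_le fun z => le_entryRadius (hA.tsum_nnPow_ne_top h1 hj i i' j' z.2))
    (iSup_le fun z => le_entryRadius (hA.tsum_nnPow_ne_top h1 hj' i' i j z.2))

lemma entryRadius_diagBlock {C : Set ι} (h : ∀ i ∈ C, ∀ j ∉ C, A i j = 0) (i j : C) :
    entryRadius (diagBlock A C) i j = entryRadius A i j := by
  have e' : ∀ z : ℝ≥0, ∑' k, nnPow (diagBlock A C) k i j * (z : ℝ≥0∞) ^ k =
      ∑' k, nnPow A k i j * (z : ℝ≥0∞) ^ k := fun z =>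
    tsum_congr fun k => by rw [nnPow_diagBlock h]
  unfold entryRadius
  refine le_antisymm (iSup_le fun z => ?_) (iSup_le fun z => ?_)
  · exact le_entryRadius (e' z ▸ z.2)
  · exact le_entryRadius (A := diagBlock A C) (by rw [e']; exact z.2)

end Decomposition

/-! ### Logarithmic asymptotics -/

lemma tendsto_div_of_linear_bounds {x : ℕ → ℝ} {ℓ : ℝ}
    (hlow : ∀ b < ℓ, ∃ E : ℝ, ∀ᶠ n : ℕ in atTop, E + b * n ≤ x n)
    (hup : ∀ b > ℓ, ∃ E : ℝ, ∀ᶠ n : ℕ in atTop, x n ≤ E + b * n) :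
    Tendsto (fun n : ℕ => x n / n) atTop (𝓝 ℓ) := by
  have hlim : ∀ E b : ℝ, Tendsto (fun n : ℕ => E / n + b) atTop (𝓝 b) := fun E b => by
    simpa using (tendsto_const_div_atTop_nhds_zero_nat E).add_const b
  refine tendsto_order.2 ⟨fun a ha => ?_, fun a ha => ?_⟩
  · obtain ⟨b, hab, hb⟩ := exists_between ha
    obtain ⟨E, hE⟩ := hlow b hb
    filter_upwards [hE, (hlim E b).eventually_const_lt hab, eventually_gt_atTop 0] with n h1 h2 h3
    have h3' : (0 : ℝ) < n := by exact_mod_cast h3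
    refine h2.trans_le ?_
    rw [le_div_iff₀ h3', add_mul, div_mul_cancel₀ _ h3'.ne']
    exact h1
  · obtain ⟨b, hb, hab⟩ := exists_between ha
    obtain ⟨E, hE⟩ := hup b hb
    filter_upwards [hE, (hlim E b).eventually_lt_const hab, eventually_gt_atTop 0] with n h1 h2 h3
    have h3' : (0 : ℝ) < n := by exact_mod_cast h3
    refine lt_of_le_of_lt ?_ h2
    rw [div_le_iff₀ h3', add_mul, div_mul_cancel₀ _ h3'.ne']
    exact h1

lemma tendsto_log_div {x : ℕ → ℝ≥0∞} {R : ℝ≥0∞} (hx1 : ∀ n, x n ≠ ∞)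
    (hx0 : ∀ᶠ n in atTop, x n ≠ 0) (hR0 : R ≠ 0) (hR : R ≠ ∞)
    (hlow : ∀ w : ℝ≥0, R < w → ∃ δ : ℝ≥0∞, δ ≠ 0 ∧ ∀ᶠ n in atTop, δ ≤ x n * (w : ℝ≥0∞) ^ n)
    (hup : ∀ z : ℝ≥0, z ≠ 0 → (z : ℝ≥0∞) < R →
      ∃ D : ℝ≥0∞, D ≠ ∞ ∧ ∀ᶠ n in atTop, x n * (z : ℝ≥0∞) ^ n ≤ D) :
    Tendsto (fun n : ℕ => Real.log (x n).toReal / n) atTop (𝓝 (Real.log R⁻¹.toReal)) := by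
  have hRpos : 0 < R.toReal := ENNReal.toReal_pos hR0 hR
  have hlogR : Real.log R⁻¹.toReal = - Real.log R.toReal := by
    rw [ENNReal.toReal_inv, Real.log_inv]
  have hlog : ∀ (n : ℕ) (b : ℝ), x n ≠ 0 →
      Real.log (x n * ((Real.exp (-b)).toNNReal : ℝ≥0∞) ^ n).toReal =
        Real.log (x n).toReal - b * n := by
    intro n b h0
    rw [ENNReal.toReal_mul, ENNReal.toReal_pow, ENNReal.coe_toReal,
      Real.coe_toNNReal _ (Real.exp_pos _).le, Real.log_mul (ENNReal.toReal_pos h0 (hx1 n)).ne'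
      (by positivity), Real.log_pow, Real.log_exp]
    ring
  refine tendsto_div_of_linear_bounds (fun b hb => ?_) (fun b hb => ?_)
  -- With `w = exp (-b)`, the slope condition `b < -log R` becomes `R < w`.
  · have hw : R < ((Real.exp (-b)).toNNReal : ℝ≥0∞) := by
      rw [← ENNReal.ofReal_toReal hR]
      refine (ENNReal.ofReal_lt_ofReal_iff (Real.exp_pos _)).2 ?_
      rw [← Real.log_lt_iff_lt_exp hRpos]
      linarith
    obtain ⟨δ, hδ, h⟩ := hlow _ hw
    refine ⟨Real.log δ.toReal, ?_⟩
    filter_upwards [h, hx0] with n hn h0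
    have hfin : x n * ((Real.exp (-b)).toNNReal : ℝ≥0∞) ^ n ≠ ∞ :=
      ENNReal.mul_ne_top (hx1 n) (ENNReal.pow_ne_top ENNReal.coe_ne_top)
    have := Real.log_le_log (ENNReal.toReal_pos hδ (ne_top_of_le_ne_top hfin hn))
      (ENNReal.toReal_mono hfin hn)
    rw [hlog n b h0] at this
    linarith
  · have hz : ((Real.exp (-b)).toNNReal : ℝ≥0∞) < R := by
      rw [← ENNReal.ofReal_toReal hR]
      refine (ENNReal.ofReal_lt_ofReal_iff hRpos).2 ?_
      rw [← Real.lt_log_iff_exp_lt hRpos]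
      linarith
    have hz0 : (Real.exp (-b)).toNNReal ≠ 0 := by
      simpa using Real.exp_pos (-b)
    obtain ⟨D, hD, h⟩ := hup _ hz0 hz
    refine ⟨Real.log D.toReal, ?_⟩
    filter_upwards [h, hx0] with n hn h0
    have hne : x n * ((Real.exp (-b)).toNNReal : ℝ≥0∞) ^ n ≠ 0 :=
      mul_ne_zero h0 (pow_ne_zero _ (by simpa using Real.exp_pos (-b)))
    have := Real.log_le_log (ENNReal.toReal_pos hne (ne_top_of_le_ne_top hD hn))
      (ENNReal.toReal_mono hD hn)
    rw [hlog n b h0] at this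
    linarith

/-! ### Asymptotics of the hitting probabilities -/

namespace QBD

variable {Φ : Type*} [MeasurableSpace Φ] [DiscreteMeasurableSpace Φ] [Countable Φ] (X : QBD Φ)

lemma nnPow_H (hirr : X.Irreducible) (n : ℕ) (i j : Φ) : nnPow X.H n i j = X.ladder n i j := by
  rw [X.H_eq_ladder hirr, nnPow_ladder_one]

lemma shiftComparable_H (hirr : X.Irreducible) (hcond : X.DoublyInfiniteIrreducible) :
    ShiftComparable X.H := by
  intro i j a
  simp_rw [X.nnPow_H hirr]
  exact X.exists_mul_ladder_le hirr hcond i j a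

lemma nnPow_H_eq_iSup (hirr : X.Irreducible) (n : ℕ) (i j : Φ) :
    nnPow X.H n i j = ⨆ k, X.hitProb k (k + n) i j := by
  rw [X.nnPow_H hirr, X.ladder_eq_iSup hirr]

lemma nnPow_H_le_one (hirr : X.Irreducible) (n : ℕ) (i j : Φ) : nnPow X.H n i j ≤ 1 := by
  rw [X.nnPow_H_eq_iSup hirr]
  exact iSup_le fun k => X.hitProb_le_one _ _ _ _

lemma hitProb_le_nnPow_H (hirr : X.Irreducible) {k K : ℕ} (hk : k ≤ K) (i j : Φ) :
    X.hitProb k K i j ≤ nnPow X.H (K - k) i j := by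
  rw [X.nnPow_H_eq_iSup hirr]
  refine le_iSup_of_le k ?_
  rw [Nat.add_sub_cancel' hk]

lemma hitProb_ne_zero_trans (hirr : X.Irreducible) {k K M : ℕ} (h1 : k ≤ K) (h2 : K ≤ M)
    {i l j : Φ} (h : X.hitProb k K i l ≠ 0) (h' : X.hitProb K M l j ≠ 0) :
    X.hitProb k M i j ≠ 0 := fun h0 =>
  mul_ne_zero h h' (le_zero_iff.1 (h0 ▸ X.hitProb_mul_le hirr h1 h2 i l j))

lemma exists_hitProb_ne_zero (hirr : X.Irreducible) {n : ℕ} {i j : Φ}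
    (h : nnPow X.H n i j ≠ 0) : ∃ k₀, ∀ k ≥ k₀, X.hitProb k (k + n) i j ≠ 0 := by
  rw [X.nnPow_H_eq_iSup hirr] at h
  obtain ⟨k₀, hk₀⟩ := lt_iSup_iff.1 (pos_iff_ne_zero.2 h)
  exact ⟨k₀, fun k hk => (hk₀.trans_le (X.hitProb_add_mono hirr n i j hk)).ne'⟩

lemma hitProb_mul_self_ne_zero (hirr : X.Irreducible) {n k₀ : ℕ} {j : Φ}
    (h : ∀ k ≥ k₀, X.hitProb k (k + n) j j ≠ 0) (a : ℕ) :
    ∀ k ≥ k₀, X.hitProb k (k + a * n) j j ≠ 0 := by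
  induction a with
  | zero =>
    intro k _
    rw [X.hitProb_eq_levelPotential hirr (Nat.le_add_right _ _), levelPotential,
      potential_of_notMem (by simp)]
    simp
  | succ a ih =>
    intro k hk
    refine X.hitProb_ne_zero_trans hirr (Nat.le_add_right _ _)
      (by rw [Nat.succ_mul]; omega) (ih k hk) (l := j) ?_
    rw [Nat.succ_mul, ← add_assoc]
    exact h _ (hk.trans (Nat.le_add_right _ _))

/-- Positivity for `H` passes to `hitProb` only at high levels, so finitely many exponents must
suffice: one connection from `i` to `j` and two returns to `j` of consecutive lengths `n + 1` and `n
+ 2`. -/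
lemma eventually_hitProb_ne_zero (hirr : X.Irreducible) (hcond : X.DoublyInfiniteIrreducible)
    (i : Φ) {j : Φ} (hj : j ∈ cyclicIndices X.H) :
    ∃ kstar : ℕ, ∀ k > kstar, ∀ᶠ K in atTop, X.hitProb k K i j ≠ 0 := by
  have hA := X.shiftComparable_H hirr hcond
  obtain ⟨m, hm⟩ := (hA.eventually_nnPow_ne_zero hj i).exists
  obtain ⟨n, hn⟩ := eventually_atTop.1 (hA.eventually_nnPow_ne_zero hj j)
  obtain ⟨k₀, hk₀⟩ := X.exists_hitProb_ne_zero hirr hm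
  obtain ⟨k₁, hk₁⟩ := X.exists_hitProb_ne_zero hirr (hn (n + 1) (by omega))
  obtain ⟨k₂, hk₂⟩ := X.exists_hitProb_ne_zero hirr (hn (n + 1 + 1) (by omega))
  refine ⟨max k₀ (max k₁ k₂), fun k hk => ?_⟩
  simp only [gt_iff_lt, max_lt_iff] at hk
  refine eventually_atTop.2 ⟨k + m + (n + 1) * (n + 1), fun K hK => ?_⟩
  obtain ⟨L, rfl⟩ := Nat.exists_eq_add_of_le ((Nat.le_add_right _ _).trans hK)
  have hL : (n + 1) * (n + 1) ≤ L := by omega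
  have hq : n + 1 ≤ L / (n + 1) := (Nat.le_div_iff_mul_le n.succ_pos).2 hL
  have hr := L.mod_lt n.succ_pos
  have hdm := Nat.div_add_mod L (n + 1)
  obtain ⟨a, ha⟩ := Nat.exists_eq_add_of_le (hr.le.trans hq)
  -- If `L = q (n + 1) + r` with `r ≤ q`, then `r` of the `q` returns are lengthened by one; `a = q
  -- - r` remain.
  have e : L = a * (n + 1) + L % (n + 1) * (n + 1 + 1) := by
    rw [ha] at hdm
    nlinarith
  rw [e]
  refine X.hitProb_ne_zero_trans hirr (Nat.le_add_right _ _) (by omega) (hk₀ k hk.1.le) (l := j) ?_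
  refine X.hitProb_ne_zero_trans hirr (Nat.le_add_right _ _) (by omega)
    (X.hitProb_mul_self_ne_zero hirr hk₁ a _ (by omega)) (l := j) ?_
  rw [← add_assoc]
  exact X.hitProb_mul_self_ne_zero hirr hk₂ _ _ (by omega)

/-- Inserting a return of length `n` whose weight is at least one does not decrease the weighted
probability. It is thus nondecreasing in `K` along each residue class modulo `n`, and `δ` is the
minimum over one period. -/
lemma exists_le_hitProb_mul_pow (hirr : X.Irreducible) {i j : Φ} {k : ℕ}
    (hk : ∀ᶠ K in atTop, X.hitProb k K i j ≠ 0) {w : ℝ≥0} (hw : entryRadius X.H j j < w) :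
    ∃ δ : ℝ≥0∞, δ ≠ 0 ∧ ∀ᶠ K in atTop, δ ≤ X.hitProb k K i j * (w : ℝ≥0∞) ^ K := by
  have hw0 : (w : ℝ≥0∞) ≠ 0 := (pos_of_gt hw).ne'
  obtain ⟨n, hn, h⟩ := exists_one_lt_nnPow_mul_pow hw
  rw [X.nnPow_H_eq_iSup hirr, ENNReal.iSup_mul] at h
  obtain ⟨k₀, hk₀⟩ := lt_iSup_iff.1 h
  have hbase : ∀ l ≥ k₀, 1 ≤ X.hitProb l (l + n) j j * (w : ℝ≥0∞) ^ n := fun l hl =>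
    hk₀.le.trans (mul_le_mul_left (X.hitProb_add_mono hirr n j j hl) _)
  have hiter : ∀ t, ∀ l ≥ k₀, l ≥ k → X.hitProb k l i j * (w : ℝ≥0∞) ^ l ≤
      X.hitProb k (l + t * n) i j * (w : ℝ≥0∞) ^ (l + t * n) := by
    intro t
    induction t with
    | zero => intro l _ _; simp
    | succ t ih =>
      intro l hl hlk
      refine (ih l hl hlk).trans ?_
      rw [Nat.succ_mul, ← add_assoc]
      set r := l + t * n
      have hrk : k ≤ r := hlk.trans (Nat.le_add_right _ _)
      calc X.hitProb k r i j * (w : ℝ≥0∞) ^ r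
          ≤ X.hitProb k r i j * (w : ℝ≥0∞) ^ r *
            (X.hitProb r (r + n) j j * (w : ℝ≥0∞) ^ n) :=
            le_mul_of_one_le_right' (hbase r (hl.trans (Nat.le_add_right _ _)))
        _ = X.hitProb k r i j * X.hitProb r (r + n) j j * (w : ℝ≥0∞) ^ (r + n) := by
            rw [pow_add]; ring
        _ ≤ _ := by
            gcongr
            exact X.hitProb_mul_le hirr hrk (Nat.le_add_right _ _) _ _ _
  obtain ⟨K₀, hK₀⟩ := eventually_atTop.1 hk
  set k₁ := max K₀ (max k₀ k) with hk₁
  have hne : (Finset.range n).Nonempty := Finset.nonempty_range_iff.2 hn.ne'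
  set f : ℕ → ℝ≥0∞ := fun s => X.hitProb k (k₁ + s) i j * (w : ℝ≥0∞) ^ (k₁ + s) with hf
  refine ⟨(Finset.range n).inf' hne f, ?_, eventually_atTop.2 ⟨k₁, fun K hK => ?_⟩⟩
  · obtain ⟨s, -, hs⟩ := Finset.exists_mem_eq_inf' hne f
    rw [hs]
    exact mul_ne_zero (hK₀ _ (by omega)) (pow_ne_zero _ hw0)
  · obtain ⟨L, rfl⟩ := Nat.exists_eq_add_of_le hK
    refine (Finset.inf'_le f (Finset.mem_range.2 (L.mod_lt hn))).trans ?_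
    have := hiter (L / n) (k₁ + L % n) (by omega) (by omega)
    have e : k₁ + L % n + L / n * n = k₁ + L := by
      rw [add_assoc, mul_comm, Nat.mod_add_div]
    rwa [e] at this

lemma exists_hitProb_mul_pow_le (hirr : X.Irreducible) {i j : Φ} (k : ℕ) {z : ℝ≥0}
    (hz : (z : ℝ≥0∞) < entryRadius X.H i j) :
    ∃ D : ℝ≥0∞, D ≠ ∞ ∧ ∀ᶠ K in atTop, X.hitProb k K i j * (z : ℝ≥0∞) ^ K ≤ D := by
  refine ⟨(∑' n, nnPow X.H n i j * (z : ℝ≥0∞) ^ n) * (z : ℝ≥0∞) ^ k,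
    ENNReal.mul_ne_top (tsum_nnPow_ne_top_of_lt hz) (ENNReal.pow_ne_top ENNReal.coe_ne_top),
    eventually_atTop.2 ⟨k, fun K hK => ?_⟩⟩
  calc X.hitProb k K i j * (z : ℝ≥0∞) ^ K
      ≤ nnPow X.H (K - k) i j * (z : ℝ≥0∞) ^ K := by
        gcongr
        exact X.hitProb_le_nnPow_H hirr hK i j
    _ = nnPow X.H (K - k) i j * (z : ℝ≥0∞) ^ (K - k) * (z : ℝ≥0∞) ^ k := by
        rw [mul_assoc, ← pow_add, Nat.sub_add_cancel hK]
    _ ≤ _ := by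
        gcongr
        exact ENNReal.le_tsum (f := fun n => nnPow X.H n i j * (z : ℝ≥0∞) ^ n) _

end QBD

end

/-! ### Assembly of the decomposition, the decay rate and the vanishing entries. -/

theorem theorem7p3 {Φ : Type*} [Countable Φ] [MeasurableSpace Φ] [DiscreteMeasurableSpace Φ]
    (X : QBD Φ) (hirr : X.Irreducible) (hcond : X.DoublyInfiniteIrreducible)
    (hdrift : X.NegativeDrift) :
    (∃! C : Set Φ, IsPrimitiveDecomposition X.H C) ∧
    ∀ C : Set Φ, IsPrimitiveDecomposition X.H C →
      (∃ c : ℝ, 0 < c ∧ IsConvergenceNorm (diagBlock X.H C) (ENNReal.ofReal c) ∧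
        ∀ i : Φ, ∀ j ∈ C, ∃ kstar : ℕ, ∀ k > kstar,
          (∀ᶠ K : ℕ in atTop, 0 < X.hitProb k K i j) ∧
          Tendsto (fun K : ℕ => Real.log (X.hitProb k K i j).toReal / (K : ℝ)) atTop
            (𝓝 (Real.log c))) ∧
      (∀ i ∉ C, ∀ j ∉ C, ∀ k : ℕ, ∃ Kstar : ℕ, ∀ K > Kstar, X.hitProb k K i j = 0) ∧
      (∀ i ∈ C, ∀ j ∉ C, ∀ k K : ℕ, k < K → X.hitProb k K i j = 0) := by
  have hA := X.shiftComparable_H hirr hcond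
  have h1 := X.nnPow_H_le_one hirr
  have hrow : ∀ i, ∃ l, X.H i l ≠ 0 := fun i => by
    rw [X.H_eq_ladder hirr]
    exact X.exists_ladder_one_ne_zero hirr hcond i
  have hne : Nonempty Φ := by
    obtain ⟨x, -, hx, -⟩ := hdrift
    by_contra hempty
    rw [not_nonempty_iff] at hempty
    exact one_ne_zero (hx.unique hasSum_empty)
  have hdec := hA.isPrimitiveDecomposition hrow
  refine ⟨⟨_, hdec, fun C hC => hA.eq_cyclicIndices hC⟩, fun C hC => ?_⟩
  obtain rfl := hA.eq_cyclicIndices hC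
  refine ⟨?_, fun i _ j hj k => ?_, fun i hi j hj k K hkK => ?_⟩
  · obtain ⟨j₀, hj₀⟩ := hC.nonempty
    set R := entryRadius X.H j₀ j₀ with hR
    have hR0 : R ≠ 0 := (entryRadius_pos h1 j₀ j₀).ne'
    have hRtop : R ≠ ∞ := entryRadius_self_ne_top hj₀ fun n => h1 n j₀ j₀
    have hall : ∀ i, ∀ j ∈ cyclicIndices X.H, entryRadius X.H i j = R := fun i j hj =>
      hA.entryRadius_eq h1 hj hj₀ i j₀
    refine ⟨R⁻¹.toReal, ENNReal.toReal_pos (ENNReal.inv_ne_zero.2 hRtop)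
      (ENNReal.inv_ne_top.2 hR0), fun i j => ?_, fun i j hj => ?_⟩
    · rw [entryRadius_diagBlock hC.upper_right, hall i j j.2,
        ENNReal.ofReal_toReal (ENNReal.inv_ne_top.2 hR0), inv_inv]
    · obtain ⟨kstar, hk⟩ := X.eventually_hitProb_ne_zero hirr hcond i hj
      refine ⟨kstar, fun k hkk => ⟨(hk k hkk).mono fun K hK => pos_iff_ne_zero.2 hK, ?_⟩⟩
      refine tendsto_log_div
        (fun K => ne_top_of_le_ne_top ENNReal.one_ne_top (X.hitProb_le_one k K i j))
        (hk k hkk) hR0 hRtop (fun w hw => ?_) (fun z _ hz => ?_)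
      · exact X.exists_le_hitProb_mul_pow hirr (hk k hkk) (by rwa [hall j j hj])
      · exact X.exists_hitProb_mul_pow_le hirr k (by rwa [hall i j hj])
  · obtain ⟨M, hM⟩ := hA.eventually_nnPow_eq_zero hC.nonempty i
    refine ⟨k + M, fun K hK => le_zero_iff.1 ?_⟩
    rw [← hM (K - k) (by omega) j hj]
    exact X.hitProb_le_nnPow_H hirr (by omega) i j
  · refine le_zero_iff.1 ?_
    rw [← nnPow_eq_zero_of_closed hC.upper_right (K - k) hi hj]
    exact X.hitProb_le_nnPow_H hirr hkK.le i j
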